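/- Let $M$ be a smooth manifold of dimension $m$ and let $(\omega_1,\dots,\omega_k)$ be a $k$-polysymplectic structure on $M$, i.e. smooth closed 2-forms with $\bigcap_{A}\ker\omega_A=0$. Write $\bar\omega^\flat(X)=(\omega_1(X,\cdot),\dots,\omega_k(X,\cdot))$ and $(T^1_k)^*M=T^*M\oplus\cdots\oplus T^*M$ ($k$ copies). Let $D\subseteq TM$ be a regular involutive distribution of rank $r$ such that $D(p)\cap D^\perp(p)=\{0\}$ for every $p\in M$, where $D^\perp(p)=\{X\in T_pM:\ \omega_A(X,Y)=0\text{ for all }A\text{ and all }Y\in D(p)\}$. For $p\in M$ put $$S(p)=\{\bar\alpha=(\alpha_1,\dots,\alpha_k)\in (T^1_k)^*_pM:\ \exists X\in D(p),\ \bar\alpha|_{D(p)}=\bar\omega^\flat(X)|_{D(p)}\}.$$ Then: 1. $\dim S(p)=r+(m-r)k$ for every $p$, and for every $\bar\alpha\in S(p)$ there is exactly one $X\in D(p)$ with $\bar\omega^\flat(X)|_{D(p)}=\bar\alpha|_{D(p)}$; setting $\bar\Lambda^\sharp(\bar\alpha)=X$ defines a linear map $\bar\Lambda^\sharp:S(p)\to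 T_pM$. 2. $(S,\bar\Lambda^\sharp)$ is a $k$-poly-Poisson structure on $M$: $S$ is a smooth vector subbundle of $(T^1_k)^*M$, $\bar\Lambda^\sharp:S\to TM$ is a smooth vector bundle morphism, and (i) $\bar\alpha(\bar\Lambda^\sharp(\bar\alpha))=0$ for $\bar\alpha\in S$; (ii) if $\bar\alpha\in S(p)$ and $\bar\alpha(\bar\Lambda^\sharp(\bar\beta))=0$ for all $\bar\beta\in S(p)$, then $\bar\Lambda^\sharp(\bar\alpha)=0$; (iii) for all (local or global) smooth sections $\bar\alpha,\bar\beta$ of $S$, the section $\mathcal L_{\bar\Lambda^\sharp(\bar\alpha)}\bar\beta-\mathcal L_{\bar\Lambda^\sharp(\bar\beta)}\bar\alpha-\mathrm d(\bar\beta(\bar\Lambda^\sharp(\bar\alpha)))$ takes values in $S$, and $$[\bar\Lambda^\sharp(\bar\alpha),\bar\Lambda^\sharp(\bar\beta)]=\bar\Lambda^\sharp\big(\mathcal L_{\bar\Lambda^\sharp(\bar\alpha)}\bar\beta-\mathcal L_{\bar\Lambda^\sharp(\bar\beta)}\bar\alpha-\mathrm d(\bar\beta(\bar\Lambda^\sharp(\bar\alpha)))\big).$$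 3. The characteristic distribution of its canonical polysymplectic foliation is $D$, i.e. $\bar\Lambda^\sharp(S(p))=D(p)$ for every $p$. For every leaf $\iota:L\to M$ of $D$, and more generally for every injectively immersed integral manifold of $D$ (so $\mathrm d\iota(T_qL)=D(\iota(q))$ for all $q\in L$), the pulled-back forms $(\iota^*\omega_1,\dots,\iota^*\omega_k)$ are a $k$-polysymplectic structure on $L$, and they are the forms induced by $(S,\bar\Lambda^\sharp)$: $(\iota^*\omega_A)(u,\cdot)=\iota^*\alpha_A$ for each $A$ whenever $u\in T_qL$ and $\bar\alpha\in S(\iota(q))$ satisfy $\bar\Lambda^\sharp(\bar\alpha)=\mathrm d\iota(u)$. -/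

import Mathlib

open scoped Manifold ContDiff Topology

noncomputable section

namespace PolyPoisson

/-- The model space `ℝⁿ`. Manifolds are boundaryless and modelled on it through `𝓡 n`. -/
abbrev Model (n : ℕ) : Type := EuclideanSpace ℝ (Fin n)

section Basic

variable {n : ℕ} {M : Type*} [TopologicalSpace M] [ChartedSpace (Model n) M]

/-- The tangent space `T_p M`. -/
abbrev Tan (n : ℕ) {M : Type*} [TopologicalSpace M] [ChartedSpace (Model n) M] (p : M) : Type :=
  TangentSpace (𝓡 n) p

/-- The cotangent space `T_p^* M`. -/
abbrev Cotan (n : ℕ) {M : Type*} [TopologicalSpace M] [ChartedSpace (Model n) M] (p : M) : Type :=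
  Tan n p →L[ℝ] ℝ

/-- The fibre at `p` of `(T^1_k)^* M = T^*M ⊕ ⋯ ⊕ T^*M` (`k` copies). -/
abbrev Covel (n k : ℕ) {M : Type*} [TopologicalSpace M] [ChartedSpace (Model n) M] (p : M) :
    Type :=
  Fin k → Cotan n p

variable (n M) in
/-- (Not necessarily smooth) vector fields. -/
abbrev VField : Type _ := (p : M) → Tan n p

variable (n M) in
/-- (Not necessarily smooth) differential two-forms. -/
abbrev TwoForm : Type _ := (p : M) → Tan n p [⋀^Fin 2]→L[ℝ] ℝ

/-! ### Two-forms -/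

/-- Pull-back of a two-form under a map of manifolds. -/
def TwoForm.pullback {a : ℕ} {N : Type*} [TopologicalSpace N] [ChartedSpace (Model a) N]
    (f : N → M) (Ω : TwoForm n M) : TwoForm a N :=
  fun q => (Ω (f q)).compContinuousLinearMap (mfderiv (𝓡 a) (𝓡 n) f q)

/-- The expression of a two-form in the chart around `x`, a two-form on `ℝⁿ`
(meaningful on the target of the chart). -/
def TwoForm.inChart (Ω : TwoForm n M) (x : M) : Model n → Model n [⋀^Fin 2]→L[ℝ] ℝ :=
  TwoForm.pullback (n := n) (a := n) (extChartAt (𝓡 n) x).symm Ω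

/-- Smoothness of a two-form, in charts. -/
def TwoForm.IsSmooth (Ω : TwoForm n M) : Prop :=
  ∀ x : M, ContDiffOn ℝ ∞ (TwoForm.inChart Ω x) (extChartAt (𝓡 n) x).target

/-- Closedness `dΩ = 0` of a two-form, in charts. -/
def TwoForm.IsClosed (Ω : TwoForm n M) : Prop :=
  ∀ x : M, ∀ y ∈ (extChartAt (𝓡 n) x).target, extDeriv (TwoForm.inChart Ω x) y = 0

theorem update_zero {V : Type*} (a b x : V) : Function.update ![a, b] 0 x = ![x, b] := by
  ext i; fin_cases i <;> simp

theorem update_one {V : Type*} (a b x : V) : Function.update ![a, b] 1 x = ![a, x] := by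
  ext i; fin_cases i <;> simp

/-- The map `Ω^♭ : T_p M → T_p^* M`, `v ↦ Ω(v, ·)`. -/
def TwoForm.flat (Ω : TwoForm n M) (p : M) : Tan n p →ₗ[ℝ] Cotan n p where
  toFun v :=
    { toFun := fun w => Ω p ![v, w]
      map_add' := fun w w' => by
        have h := (Ω p).map_update_add' ![v, 0] 1 w w'
        rwa [update_one, update_one, update_one] at h
      map_smul' := fun c w => by
        have h := (Ω p).map_update_smul' ![v, 0] 1 c w
        rwa [update_one, update_one] at h
      cont := by
        refine (Ω p).cont.comp (continuous_pi fun i => ?_)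
        fin_cases i
        · exact continuous_const
        · exact continuous_id }
  map_add' v v' := by
    ext w
    have h := (Ω p).map_update_add' ![0, w] 0 v v'
    rwa [update_zero, update_zero, update_zero] at h
  map_smul' c v := by
    ext w
    have h := (Ω p).map_update_smul' ![0, w] 0 c v
    rwa [update_zero, update_zero] at h

/-- A `k`-polysymplectic structure: `k` smooth closed two-forms with `⋂ Ker Ω_A = 0`. -/
structure IsPolysymplectic {k : ℕ} (Ω : Fin k → TwoForm n M) : Prop where
  smooth : ∀ A, TwoForm.IsSmooth (Ω A)
  closed : ∀ A, TwoForm.IsClosed (Ω A)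
  nondegenerate : ∀ p : M, (⨅ A, LinearMap.ker (TwoForm.flat (Ω A) p)) = ⊥

/-! ### One-forms -/

/-- The expression of a vector field in the chart around `x`
(meaningful on the target of the chart). -/
def fieldInChart (X : VField n M) (x : M) : Model n → Model n :=
  VectorField.mpullback (𝓡 n) (𝓡 n) (extChartAt (𝓡 n) x).symm X

/-- The expression of a one-form in the chart around `x`
(meaningful on the target of the chart). -/
def oneFormInChart (α : (p : M) → Cotan n p) (x : M) : Model n → Model n →L[ℝ] ℝ :=
  fun y => (α ((extChartAt (𝓡 n) x).symm y)).comp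
    (mfderiv (𝓡 n) (𝓡 n) (extChartAt (𝓡 n) x).symm y)

/-- The Lie derivative `L_X α` of a one-form on `ℝⁿ`: `(L_X α)(v) = (Dα · X)(v) + α(DX · v)`. -/
def lieDerivModel (X : Model n → Model n) (α : Model n → Model n →L[ℝ] ℝ) (y : Model n) :
    Model n →L[ℝ] ℝ :=
  fderiv ℝ α y (X y) + (α y).comp (fderiv ℝ X y)

/-- The Lie derivative `L_X α` of a one-form at `p`, computed in the chart around `p`. -/
def lieDeriv (X : VField n M) (α : (p : M) → Cotan n p) (p : M) : Cotan n p :=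
  (lieDerivModel (fieldInChart X p) (oneFormInChart α p) (extChartAt (𝓡 n) p p)).comp
    (mfderiv (𝓡 n) (𝓡 n) (extChartAt (𝓡 n) p) p)

/-- The differential of a real function at `p`. -/
def diff (f : M → ℝ) (p : M) : Cotan n p := mfderiv (𝓡 n) 𝓘(ℝ, ℝ) f p

end Basic

section Bundles

variable {n : ℕ} {M : Type*} [TopologicalSpace M] [ChartedSpace (Model n) M]
  [IsManifold (𝓡 n) ∞ M]

/-- The vector field `X` is smooth on `U`. -/
def SmoothFieldOn (X : VField n M) (U : Set M) : Prop :=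
  ContMDiffOn (𝓡 n) ((𝓡 n).prod 𝓘(ℝ, Model n)) ∞
    (fun p => Bundle.TotalSpace.mk' (Model n) (E := fun p : M => TangentSpace (𝓡 n) p) p (X p)) U

/-- The section `α` of `(T^1_k)^* M` is smooth on `U`: each of its components is a smooth section
of the cotangent bundle. -/
def SmoothCovelOn {k : ℕ} (α : (p : M) → Covel n k p) (U : Set M) : Prop :=
  ∀ A, ContMDiffOn (𝓡 n) ((𝓡 n).prod 𝓘(ℝ, Model n →L[ℝ] ℝ)) ∞
    (fun p => Bundle.TotalSpace.mk' (Model n →L[ℝ] ℝ)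
      (E := fun p : M => TangentSpace (𝓡 n) p →L[ℝ] Bundle.Trivial M ℝ p) p (α p A)) U

/-- A regular distribution of rank `r`: a smooth rank `r` subbundle of `TM`. -/
def IsRegularDistribution (D : (p : M) → Submodule ℝ (Tan n p)) (r : ℕ) : Prop :=
  ∀ p : M, ∃ U : Set M, IsOpen U ∧ p ∈ U ∧ ∃ X : Fin r → VField n M,
    (∀ i, SmoothFieldOn (X i) U) ∧
    ∀ q ∈ U, LinearIndependent ℝ (fun i => X i q) ∧
      Submodule.span ℝ (Set.range fun i => X i q) = D q

/-- Involutivity: the bracket of two smooth local sections of `D` is a section of `D`. -/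
def IsInvolutive (D : (p : M) → Submodule ℝ (Tan n p)) : Prop :=
  ∀ U : Set M, IsOpen U → ∀ X Y : VField n M, SmoothFieldOn X U → SmoothFieldOn Y U →
    (∀ p ∈ U, X p ∈ D p) → (∀ p ∈ U, Y p ∈ D p) →
    ∀ p ∈ U, VectorField.mlieBracket (𝓡 n) X Y p ∈ D p

/-- A smooth vector subbundle of `(T^1_k)^* M` (locally of constant rank, with smooth local
frames). -/
def IsSubbundle {k : ℕ} (S : (p : M) → Submodule ℝ (Covel n k p)) : Prop :=
  ∀ p : M, ∃ U : Set M, IsOpen U ∧ p ∈ U ∧ ∃ (s : ℕ) (σ : Fin s → (p : M) → Covel n k p),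
    (∀ i, SmoothCovelOn (σ i) U) ∧
    ∀ q ∈ U, LinearIndependent ℝ (fun i => σ i q) ∧
      Submodule.span ℝ (Set.range fun i => σ i q) = S q

open Classical in
/-- The vector field `Λ^♯(α)` for `α` with values in `S`; it is only used at points and on open
sets where `α` is a section of `S`, and is set to `0` elsewhere. -/
def sharp {k : ℕ} {S : (p : M) → Submodule ℝ (Covel n k p)}
    (Λ : (p : M) → S p →ₗ[ℝ] Tan n p) (α : (p : M) → Covel n k p) : VField n M :=
  fun p => if h : α p ∈ S p then Λ p ⟨α p, h⟩ else 0

/-- A `k`-poly-Poisson structure `(S, Λ^♯)` on `M`. Sections are taken over arbitrary open sets,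
which includes the global ones. The integrability condition includes that the argument of `Λ^♯`
on its right-hand side lies in `S`. -/
structure IsPolyPoisson {k : ℕ} (S : (p : M) → Submodule ℝ (Covel n k p))
    (Λ : (p : M) → S p →ₗ[ℝ] Tan n p) : Prop where
  /-- `S` is a vector subbundle. -/
  subbundle : IsSubbundle S
  /-- `Λ^♯` is a smooth morphism of vector bundles. -/
  smooth : ∀ U : Set M, IsOpen U → ∀ α : (p : M) → Covel n k p, SmoothCovelOn α U →
    (∀ p ∈ U, α p ∈ S p) → SmoothFieldOn (sharp Λ α) U
  /-- `α(Λ^♯(α)) = 0`. -/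
  skew : ∀ (p : M) (α : S p) (A : Fin k), α.1 A (Λ p α) = 0
  /-- If `α(Λ^♯(β)) = 0` for every `β`, then `Λ^♯(α) = 0`. -/
  nondegenerate : ∀ (p : M) (α : S p), (∀ (β : S p) (A : Fin k), α.1 A (Λ p β) = 0) → Λ p α = 0
  /-- `[Λ^♯α, Λ^♯β] = Λ^♯(L_{Λ^♯α} β - L_{Λ^♯β} α - d(β(Λ^♯α)))`. -/
  integrable : ∀ U : Set M, IsOpen U → ∀ α β : (p : M) → Covel n k p,
    SmoothCovelOn α U → SmoothCovelOn β U → (∀ p ∈ U, α p ∈ S p) → (∀ p ∈ U, β p ∈ S p) →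
    ∀ p ∈ U, ∃ h : (fun A => lieDeriv (sharp Λ α) (fun q => β q A) p
          - lieDeriv (sharp Λ β) (fun q => α q A) p
          - diff (fun q => β q A (sharp Λ α q)) p) ∈ S p,
      VectorField.mlieBracket (𝓡 n) (sharp Λ α) (sharp Λ β) p = Λ p ⟨_, h⟩

/-! ### Integral manifolds -/

/-- `ι : L → M` is an injectively immersed integral manifold of the distribution `D`:
`dι(T_q L) = D(ι q)`. The leaves of `D` are the maximal connected ones. -/
structure IsIntegralManifold {a : ℕ} {L : Type*} [TopologicalSpace L] [ChartedSpace (Model a) L]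
    (D : (p : M) → Submodule ℝ (Tan n p)) (ι : L → M) : Prop where
  smooth : ContMDiff (𝓡 a) (𝓡 n) ∞ ι
  injective : Function.Injective ι
  immersion : ∀ q : L, Function.Injective (mfderiv (𝓡 a) (𝓡 n) ι q)
  tangent : ∀ q : L, LinearMap.range (mfderiv (𝓡 a) (𝓡 n) ι q).toLinearMap = D (ι q)

/-- The family `η` on `L` is the one induced by the poly-Poisson structure `(S, Λ^♯)`:
`η^♭(u) = ι^* α` for every `α ∈ S` with `Λ^♯(α) = dι(u)`. -/
def IsInducedForm {a k : ℕ} {L : Type*} [TopologicalSpace L] [ChartedSpace (Model a) L]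
    {S : (p : M) → Submodule ℝ (Covel n k p)} (Λ : (p : M) → S p →ₗ[ℝ] Tan n p) (ι : L → M)
    (η : Fin k → TwoForm a L) : Prop :=
  ∀ (q : L) (u : Tan a q) (α : S (ι q)), Λ (ι q) α = mfderiv (𝓡 a) (𝓡 n) ι q u →
    ∀ A, TwoForm.flat (η A) q u = (α.1 A).comp (mfderiv (𝓡 a) (𝓡 n) ι q)

end Bundles

section Dirac

variable {n k : ℕ} {M : Type*} [TopologicalSpace M] [ChartedSpace (Model n) M]

/-- The annihilator `W° ⊆ T_p^* M` of a subspace `W ⊆ T_p M`. -/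
def annihilator {p : M} (W : Submodule ℝ (Tan n p)) : Submodule ℝ (Cotan n p) where
  carrier := {α | ∀ w ∈ W, α w = 0}
  add_mem' := fun {α β} hα hβ w hw => by simp [hα w hw, hβ w hw]
  zero_mem' := fun w _ => by simp
  smul_mem' := fun c α hα w hw => by simp [hα w hw]

/-- The polysymplectic orthogonal `D^⊥(p) = ⋂_A (Ω_A^♭)⁻¹(D°(p))`. -/
def orthogonal (Ω : Fin k → TwoForm n M) (D : (p : M) → Submodule ℝ (Tan n p)) (p : M) :
    Submodule ℝ (Tan n p) :=
  ⨅ A, (annihilator (D p)).comap (TwoForm.flat (Ω A) p)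

/-- The subspace `S(p)` of those `α ∈ (T^1_k)^*_p M` for which there is `X ∈ D(p)` with
`α|_{D(p)} = Ω^♭(X)|_{D(p)}`. -/
def diracS (Ω : Fin k → TwoForm n M) (D : (p : M) → Submodule ℝ (Tan n p)) (p : M) :
    Submodule ℝ (Covel n k p) where
  carrier := {α | ∃ X ∈ D p, ∀ A, ∀ w ∈ D p, α A w = TwoForm.flat (Ω A) p X w}
  add_mem' := by
    rintro α β ⟨X, hX, h⟩ ⟨Y, hY, h'⟩
    exact ⟨X + Y, (D p).add_mem hX hY, fun A w hw => by simp [h A w hw, h' A w hw]⟩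
  zero_mem' := ⟨0, (D p).zero_mem, fun A w _ => by simp⟩
  smul_mem' := by
    rintro c α ⟨X, hX, h⟩
    exact ⟨c • X, (D p).smul_mem c hX, fun A w hw => by simp [h A w hw]⟩

end Dirac

end PolyPoisson

end

open PolyPoisson

open Filter

/-! Everything rests on one reading of `D ⊓ orthogonal Ω D = ⊥`: the map X ↦ ω^♭(X)|_D is injective
on D(p) (`eq_zero_of_flat_eq_zero`). Hence each α in S(p) has a unique X, uniqueness makes Λ^♯
linear, and Λ^♯(ω^♭(X)) = X for X in D shows that its range is D. The skewness and nondegeneracy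
conditions then follow from antisymmetry of the ω_A and from the same injectivity.

If X_i is a frame of D and ε_j a frame of its annihilator, the tuples ω^♭(X_i), together with each
ε_j placed in each of the k slots, form a frame of S (`linearIndependent_diracFrame`,
`span_diracFrame`). Counting gives r + (m - r)k; choosing X_i and ε_j smooth gives the subbundle.
Smoothness of Λ^♯ holds because the coefficients of Λ^♯(α) in the frame X_i solve a smooth linear
system with injective matrix (`contDiffAt_of_injective_clm`).

For integrability, put X = Λ^♯(α), Y = Λ^♯(β) and let Z be a section of D. By involutivity [X, Z]
and [Y, Z] lie in D, so α_A and β_A may replace ω_A(X, ·) and ω_A(Y, ·) throughout the invariant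
formula for dω_A(X, Y, Z) = 0. What remains is (L_X β_A - L_Y α_A - d(β_A(X)))(Z) = ω_A([X, Y], Z)
(`lieDeriv_bracket_apply`). As [X, Y] is in D, this says at once that the tuple lies in S and that
Λ^♯ sends it to [X, Y].

On an integral manifold, pull-back preserves smoothness and closedness, and a common kernel vector
of the pulled-back forms is mapped by dι into D ∩ D^⊥ = 0. -/

namespace PolyPoisson

/-! ### Cartan calculus and smooth linear systems on the model space -/

section Model

variable {n : ℕ}

/-- The invariant formula for the exterior derivative of a two-form. -/
theorem extDeriv_twoForm_apply {E : Type*} [NormedAddCommGroup E] [NormedSpace ℝ E]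
    {η : E → E [⋀^Fin 2]→L[ℝ] ℝ} {X Y Z : E → E} {y : E}
    (hη : DifferentiableAt ℝ η y) (hX : DifferentiableAt ℝ X y) (hY : DifferentiableAt ℝ Y y)
    (hZ : DifferentiableAt ℝ Z y) :
    extDeriv η y ![X y, Y y, Z y] =
      fderiv ℝ (fun y => η y ![Y y, Z y]) y (X y) - fderiv ℝ (fun y => η y ![X y, Z y]) y (Y y)
      + fderiv ℝ (fun y => η y ![X y, Y y]) y (Z y)
      - η y ![VectorField.lieBracket ℝ X Y y, Z y] + η y ![VectorField.lieBracket ℝ X Z y, Y y]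
      - η y ![VectorField.lieBracket ℝ Y Z y, X y] := by
  have h := extDeriv_apply_vectorField (n := 1) (V := ![X, Y, Z]) hη
    (by intro i; fin_cases i <;> simpa)
  have e (i : Fin 3) (a b : Fin 3) (ha : i.succAbove 0 = a) (hb : i.succAbove 1 = b) (x : E) :
      i.removeNth (fun j => (![X, Y, Z] : Fin 3 → E → E) j x)
        = ![(![X, Y, Z] : Fin 3 → E → E) a x, (![X, Y, Z] : Fin 3 → E → E) b x] := by
    subst ha hb
    ext j; fin_cases j <;> rfl
  have e3 : (fun j => (![X, Y, Z] : Fin 3 → E → E) j y) = ![X y, Y y, Z y] := by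
    ext j; fin_cases j <;> rfl
  have f2 (i : Fin 2) (u v : E) (c : E) :
      (Matrix.vecCons c (i.removeNth ![u, v]) : Fin 2 → E) = ![c, ![u, v] (i.succAbove 0)] := by
    ext j; fin_cases j <;> rfl
  -- The bracket terms are indexed by i ≤ j in `Fin 2`, standing for the pair of arguments i < j +
  -- 1: three pairs in all.
  have hI0 : Finset.Ici (0 : Fin 2) = {0, 1} := by decide
  have hI1 : Finset.Ici (1 : Fin 2) = {1} := by decide
  have f3 : Fin.removeNth 1 (Fin.removeNth 1 ![X y, Y y, Z y]) = ![X y] := by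
    ext j; fin_cases j; rfl
  rw [e3] at h
  rw [h, Fin.sum_univ_three, Fin.sum_univ_two, hI0, hI1]
  simp only [e 0 1 2 rfl rfl, e 1 0 2 rfl rfl, e 2 0 1 rfl rfl,
    Finset.sum_pair (show (0 : Fin 2) ≠ 1 by decide), Finset.sum_singleton,
    show Fin.castSucc (0 : Fin 2) = 0 from rfl, show Fin.castSucc (1 : Fin 2) = 1 from rfl]
  simp [show (Fin.succ 1 : Fin 3) = 2 from rfl, f2, f3]
  ring

/-- A two-form is antisymmetric. -/
theorem twoForm_swap {E : Type*} [AddCommGroup E] [TopologicalSpace E] [Module ℝ E]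
    (η : E [⋀^Fin 2]→L[ℝ] ℝ) (u v : E) : η ![u, v] = - η ![v, u] := by
  have h := η.toAlternatingMap.map_swap ![v, u] (show (0 : Fin 2) ≠ 1 by decide)
  have e : (![v, u] ∘ Equiv.swap (0 : Fin 2) 1) = ![u, v] := by
    ext i; fin_cases i <;> simp
  rw [e] at h
  exact h

/-- The derivative of a pairing of a one-form and a vector field along a third field. -/
theorem lieDerivModel_apply {X Z : Model n → Model n} {a : Model n → Model n →L[ℝ] ℝ}
    {y : Model n} (hZ : DifferentiableAt ℝ Z y) (ha : DifferentiableAt ℝ a y) :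
    lieDerivModel X a y (Z y) = fderiv ℝ (fun y => a y (Z y)) y (X y)
      - a y (VectorField.lieBracket ℝ X Z y) := by
  rw [fderiv_clm_apply ha hZ]
  simp [lieDerivModel, VectorField.lieBracket]

/-- If the one-forms `a`, `b` agree with `η(X, ·)`, `η(Y, ·)` on the fields in play and `η` is
closed, then `L_X b - L_Y a - d(b(X))` agrees with `η([X, Y], ·)`. -/
theorem lieDerivModel_bracket {η : Model n → Model n [⋀^Fin 2]→L[ℝ] ℝ}
    {X Y Z : Model n → Model n} {a b : Model n → Model n →L[ℝ] ℝ} {y : Model n}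
    (hη : DifferentiableAt ℝ η y) (hX : DifferentiableAt ℝ X y) (hY : DifferentiableAt ℝ Y y)
    (hZ : DifferentiableAt ℝ Z y) (ha : DifferentiableAt ℝ a y) (hb : DifferentiableAt ℝ b y)
    (hd : extDeriv η y = 0)
    (haZ : ∀ᶠ x in 𝓝 y, a x (Z x) = η x ![X x, Z x])
    (hbZ : ∀ᶠ x in 𝓝 y, b x (Z x) = η x ![Y x, Z x])
    (hbX : ∀ᶠ x in 𝓝 y, b x (X x) = η x ![Y x, X x])
    (haYZ : a y (VectorField.lieBracket ℝ Y Z y) = η y ![X y, VectorField.lieBracket ℝ Y Z y])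
    (hbXZ : b y (VectorField.lieBracket ℝ X Z y) = η y ![Y y, VectorField.lieBracket ℝ X Z y]) :
    (lieDerivModel X b y - lieDerivModel Y a y - fderiv ℝ (fun x => b x (X x)) y) (Z y) =
      η y ![VectorField.lieBracket ℝ X Y y, Z y] := by
  have h := extDeriv_twoForm_apply hη hX hY hZ
  rw [hd] at h
  have e1 : fderiv ℝ (fun x => a x (Z x)) y = fderiv ℝ (fun x => η x ![X x, Z x]) y :=
    EventuallyEq.fderiv_eq haZ
  have e2 : fderiv ℝ (fun x => b x (Z x)) y = fderiv ℝ (fun x => η x ![Y x, Z x]) y :=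
    EventuallyEq.fderiv_eq hbZ
  -- Since b(X) = η(Y, X) = -η(X, Y), the term -d(b(X))(Z) supplies the derivative of η(X, Y) along
  -- Z in the formula for dη.
  have e3 : fderiv ℝ (fun x => b x (X x)) y = - fderiv ℝ (fun x => η x ![X x, Y x]) y := by
    rw [EventuallyEq.fderiv_eq hbX, ← fderiv_fun_neg]
    congr 1
    ext x
    exact twoForm_swap _ _ _
  simp only [sub_apply]
  rw [lieDerivModel_apply hZ ha, lieDerivModel_apply hZ hb, e1, e2, e3, haYZ, hbXZ,
    twoForm_swap _ (Y y), twoForm_swap _ (X y)]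
  change (0 : ℝ) = _ at h
  simp only [neg_apply]
  linarith

/-- Solutions of a linear system whose matrix is smooth and injective depend smoothly on the
right-hand side. -/
theorem contDiffAt_of_injective_clm {E F G : Type*} [NormedAddCommGroup E] [NormedSpace ℝ E]
    [NormedAddCommGroup F] [NormedSpace ℝ F] [FiniteDimensional ℝ F]
    [NormedAddCommGroup G] [NormedSpace ℝ G] [FiniteDimensional ℝ G]
    {T : E → F →L[ℝ] G} {c : E → F} {g : E → G} {y : E}
    (hT : ContDiffAt ℝ ∞ T y) (hg : ContDiffAt ℝ ∞ g y) (hinj : Function.Injective (T y))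
    (h : ∀ᶠ x in 𝓝 y, T x (c x) = g x) : ContDiffAt ℝ ∞ c y := by
  obtain ⟨l, hl⟩ := (T y).toLinearMap.exists_leftInverse_of_injective
    (LinearMap.ker_eq_bot.2 hinj)
  -- The left inverse is frozen at `y`. Invertibility being open, P ∘ T(x) stays invertible nearby,
  -- so c = (P ∘ T)⁻¹ P g there.
  let P : G →L[ℝ] F := LinearMap.toContinuousLinearMap l
  have hP : P.comp (T y) = ContinuousLinearMap.id ℝ F := by
    ext v; exact LinearMap.congr_fun hl v
  have hPT : ContDiffAt ℝ ∞ (fun x => P.comp (T x)) y := contDiffAt_const.clm_comp hT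
  have hinv : ContDiffAt ℝ ∞ (fun x => ContinuousLinearMap.inverse (P.comp (T x))) y := by
    have h0 : ContDiffAt ℝ ∞ (ContinuousLinearMap.inverse : (F →L[ℝ] F) → F →L[ℝ] F)
        (P.comp (T y)) := by
      rw [hP]
      exact contDiffAt_map_inverse (ContinuousLinearEquiv.refl ℝ F)
    exact h0.comp y hPT
  have hsmooth := hinv.clm_apply ((contDiffAt_const (c := P)).clm_apply hg)
  refine hsmooth.congr_of_eventuallyEq ?_
  have hunit : ∀ᶠ x in 𝓝 y, (P.comp (T x)).IsInvertible := by
    have := hPT.continuousAt.eventually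
      ((ContinuousLinearEquiv.isOpen (𝕜 := ℝ) (E := F) (F := F)).mem_nhds
        ⟨ContinuousLinearEquiv.refl ℝ F, hP.symm⟩)
    exact this
  filter_upwards [h, hunit] with x hx hu
  rw [← hx]
  exact ((hu.inverse_apply_eq).2 rfl).symm

end Model

theorem contDiffAt_congr {E F : Type*} [NormedAddCommGroup E] [NormedSpace ℝ E]
    [NormedAddCommGroup F] [NormedSpace ℝ F] {f g : E → F} {x : E} (h : f =ᶠ[𝓝 x] g) :
    ContDiffAt ℝ ∞ f x ↔ ContDiffAt ℝ ∞ g x :=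
  ⟨fun hf => hf.congr_of_eventuallyEq h.symm, fun hg => hg.congr_of_eventuallyEq h⟩

/-! ### Fields, forms, brackets and differentials read in charts -/

section Charts

variable {n : ℕ} {M : Type*} [TopologicalSpace M] [ChartedSpace (Model n) M]

theorem extChartAt_target_mem_nhds_of_mem {p : M} {y : Model n}
    (hy : y ∈ (extChartAt (𝓡 n) p).target) : (extChartAt (𝓡 n) p).target ∈ 𝓝 y :=
  (isOpen_extChartAt_target p).mem_nhds hy

variable [IsManifold (𝓡 n) ∞ M]

theorem isManifold_one : IsManifold (𝓡 n) 1 M := IsManifold.of_le (n := ∞) (by simp)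

theorem contMDiffAt_extChartAt_symm_of_mem {p : M} {y : Model n}
    (hy : y ∈ (extChartAt (𝓡 n) p).target) :
    ContMDiffAt (𝓡 n) (𝓡 n) ∞ (extChartAt (𝓡 n) p).symm y :=
  (contMDiffOn_extChartAt_symm p y hy).contMDiffAt (extChartAt_target_mem_nhds_of_mem hy)

theorem isInvertible_mfderiv_extChartAt_symm {p : M} {y : Model n}
    (hy : y ∈ (extChartAt (𝓡 n) p).target) :
    (mfderiv (𝓡 n) (𝓡 n) (extChartAt (𝓡 n) p).symm y).IsInvertible := by
  have : IsManifold (𝓡 n) 1 M := isManifold_one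
  have h := isInvertible_mfderivWithin_extChartAt_symm hy
  rwa [ModelWithCorners.range_eq_univ, mfderivWithin_univ] at h

theorem mfderiv_extChartAt_symm_comp {p q : M} (hq : q ∈ (extChartAt (𝓡 n) p).source) :
    (mfderiv (𝓡 n) (𝓡 n) (extChartAt (𝓡 n) p).symm (extChartAt (𝓡 n) p q)) ∘L
      (mfderiv (𝓡 n) (𝓡 n) (extChartAt (𝓡 n) p) q) = ContinuousLinearMap.id _ _ := by
  have : IsManifold (𝓡 n) 1 M := isManifold_one
  have h := mfderivWithin_extChartAt_symm_comp_mfderiv_extChartAt' hq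
  rwa [ModelWithCorners.range_eq_univ, mfderivWithin_univ] at h

/-- Smoothness of a map out of a manifold, read in a chart. -/
theorem contMDiffAt_iff_contDiffAt_comp_symm {F : Type*} [NormedAddCommGroup F] [NormedSpace ℝ F]
    {f : M → F} {p q : M} (hq : q ∈ (extChartAt (𝓡 n) p).source) :
    ContMDiffAt (𝓡 n) 𝓘(ℝ, F) ∞ f q ↔
      ContDiffAt ℝ ∞ (fun y => f ((extChartAt (𝓡 n) p).symm y)) (extChartAt (𝓡 n) p q) := by
  rw [contMDiffAt_iff_source_of_mem_source (x := p) (by rwa [extChartAt_source] at hq),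
    ModelWithCorners.range_eq_univ, contMDiffWithinAt_univ, contMDiffAt_iff_contDiffAt]
  rfl

/-- Smoothness of a vector field, read in a chart. -/
theorem contMDiffAt_field_iff {X : VField n M} {p q : M}
    (hq : q ∈ (extChartAt (𝓡 n) p).source) :
    ContMDiffAt (𝓡 n) ((𝓡 n).prod 𝓘(ℝ, Model n)) ∞
      (fun p => Bundle.TotalSpace.mk' (Model n) (E := fun p : M => TangentSpace (𝓡 n) p) p (X p)) q
      ↔ ContDiffAt ℝ ∞ (fieldInChart X p) (extChartAt (𝓡 n) p q) := by
  have : IsManifold (𝓡 n) 1 M := isManifold_one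
  have hq' : q ∈ (chartAt (Model n) p).source := by rwa [extChartAt_source] at hq
  rw [(trivializationAt (Model n) (TangentSpace (𝓡 n)) p).contMDiffAt_section_iff
    (by simpa using hq'), contMDiffAt_iff_contDiffAt_comp_symm hq]
  refine contDiffAt_congr ?_
  filter_upwards [extChartAt_target_mem_nhds_of_mem ((extChartAt (𝓡 n) p).map_source hq)] with y hy
  have hs := (extChartAt (𝓡 n) p).map_target hy
  have hs' : (extChartAt (𝓡 n) p).symm y ∈ (chartAt (Model n) p).source := by
    rwa [extChartAt_source] at hs
  -- The trivialization reads a vector through the differential of the chart, `fieldInChart` through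
  -- the inverse of the differential of the inverse chart. The chain rule identifies the two.
  have h1 := TangentBundle.continuousLinearMapAt_trivializationAt (I := 𝓡 n) hs'
  symm
  refine ((isInvertible_mfderiv_extChartAt_symm hy).inverse_apply_eq).2 ?_
  have h2 := mfderiv_extChartAt_symm_comp hs
  rw [(extChartAt (𝓡 n) p).right_inv hy] at h2
  have h3 := congrArg (fun l => l (X ((extChartAt (𝓡 n) p).symm y))) h2
  rw [← h1] at h3
  refine Eq.trans h3.symm ?_
  have h4 : (trivializationAt (Model n) (TangentSpace (𝓡 n)) p).continuousLinearMapAt ℝ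
      ((extChartAt (𝓡 n) p).symm y) (X ((extChartAt (𝓡 n) p).symm y)) =
      (trivializationAt (Model n) (TangentSpace (𝓡 n)) p
        ⟨(extChartAt (𝓡 n) p).symm y, X ((extChartAt (𝓡 n) p).symm y)⟩).2 := by
    rw [Bundle.Trivialization.continuousLinearMapAt_apply,
      Bundle.Trivialization.coe_linearMapAt_of_mem _ (by simpa using hs')]
  exact congrArg (mfderiv (𝓡 n) (𝓡 n) (extChartAt (𝓡 n) p).symm y) h4

/-- Smoothness of a one-form, read in a chart. -/
theorem contMDiffAt_oneForm_iff {α : (p : M) → Cotan n p} {p q : M}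
    (hq : q ∈ (extChartAt (𝓡 n) p).source) :
    ContMDiffAt (𝓡 n) ((𝓡 n).prod 𝓘(ℝ, Model n →L[ℝ] ℝ)) ∞
      (fun p => Bundle.TotalSpace.mk' (Model n →L[ℝ] ℝ)
        (E := fun p : M => TangentSpace (𝓡 n) p →L[ℝ] Bundle.Trivial M ℝ p) p (α p)) q
      ↔ ContDiffAt ℝ ∞ (oneFormInChart α p) (extChartAt (𝓡 n) p q) := by
  have : IsManifold (𝓡 n) 1 M := isManifold_one
  have hq' : q ∈ (chartAt (Model n) p).source := by rwa [extChartAt_source] at hq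
  rw [(trivializationAt (Model n →L[ℝ] ℝ)
      (fun p : M => TangentSpace (𝓡 n) p →L[ℝ] Bundle.Trivial M ℝ p) p).contMDiffAt_section_iff
    (by simpa using hq'), contMDiffAt_iff_contDiffAt_comp_symm hq]
  refine contDiffAt_congr ?_
  filter_upwards [extChartAt_target_mem_nhds_of_mem ((extChartAt (𝓡 n) p).map_source hq)] with y hy
  have hs := (extChartAt (𝓡 n) p).map_target hy
  have hs' : (extChartAt (𝓡 n) p).symm y ∈ (chartAt (Model n) p).source := by
    rwa [extChartAt_source] at hs
  have h1 := TangentBundle.symmL_trivializationAt (I := 𝓡 n) hs'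
  rw [ModelWithCorners.range_eq_univ, mfderivWithin_univ,
    (extChartAt (𝓡 n) p).right_inv hy] at h1
  rw [hom_trivializationAt_apply]
  ext v
  simp only [ContinuousLinearMap.inCoordinates, h1, oneFormInChart]
  simp

theorem SmoothFieldOn.contDiffAt {X : VField n M} {U : Set M} (hX : SmoothFieldOn X U)
    (hU : IsOpen U) {p q : M} (hq : q ∈ (extChartAt (𝓡 n) p).source) (hqU : q ∈ U) :
    ContDiffAt ℝ ∞ (fieldInChart X p) (extChartAt (𝓡 n) p q) :=
  (contMDiffAt_field_iff hq).1 ((hX q hqU).contMDiffAt (hU.mem_nhds hqU))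

theorem SmoothCovelOn.contDiffAt {k : ℕ} {α : (p : M) → Covel n k p} {U : Set M}
    (hα : SmoothCovelOn α U) (hU : IsOpen U) {p q : M} (hq : q ∈ (extChartAt (𝓡 n) p).source)
    (hqU : q ∈ U) (A : Fin k) :
    ContDiffAt ℝ ∞ (oneFormInChart (fun q => α q A) p) (extChartAt (𝓡 n) p q) :=
  (contMDiffAt_oneForm_iff hq).1 ((hα A q hqU).contMDiffAt (hU.mem_nhds hqU))

theorem mfderiv_symm_fieldInChart (X : VField n M) {p : M} {y : Model n}
    (hy : y ∈ (extChartAt (𝓡 n) p).target) :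
    mfderiv (𝓡 n) (𝓡 n) (extChartAt (𝓡 n) p).symm y (fieldInChart X p y) =
      X ((extChartAt (𝓡 n) p).symm y) :=
  (isInvertible_mfderiv_extChartAt_symm hy).self_apply_inverse _

theorem oneFormInChart_fieldInChart (α : (p : M) → Cotan n p) (X : VField n M) {p : M}
    {y : Model n} (hy : y ∈ (extChartAt (𝓡 n) p).target) :
    oneFormInChart α p y (fieldInChart X p y) =
      α ((extChartAt (𝓡 n) p).symm y) (X ((extChartAt (𝓡 n) p).symm y)) := by
  rw [← mfderiv_symm_fieldInChart X hy]
  rfl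

omit [IsManifold (𝓡 n) ∞ M] in
theorem pullback_apply {a : ℕ} {N : Type*} [TopologicalSpace N] [ChartedSpace (Model a) N]
    (f : N → M) (Ω : TwoForm n M) (q : N) (u v : Tan a q) :
    TwoForm.pullback (a := a) f Ω q ![u, v] =
      Ω (f q) ![mfderiv (𝓡 a) (𝓡 n) f q u, mfderiv (𝓡 a) (𝓡 n) f q v] := by
  change Ω (f q) _ = _
  congr 1
  ext i : 1
  fin_cases i <;> rfl

theorem inChart_fieldInChart (Ω : TwoForm n M) (X Y : VField n M) {p : M}
    {y : Model n} (hy : y ∈ (extChartAt (𝓡 n) p).target) :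
    TwoForm.inChart Ω p y ![fieldInChart X p y, fieldInChart Y p y] =
      Ω ((extChartAt (𝓡 n) p).symm y)
        ![X ((extChartAt (𝓡 n) p).symm y), Y ((extChartAt (𝓡 n) p).symm y)] := by
  rw [← mfderiv_symm_fieldInChart X hy, ← mfderiv_symm_fieldInChart Y hy]
  exact pullback_apply _ _ _ _ _

theorem oneFormInChart_mfderiv (α : (p : M) → Cotan n p) {p q : M}
    (hq : q ∈ (extChartAt (𝓡 n) p).source) (v : Tan n q) :
    oneFormInChart α p (extChartAt (𝓡 n) p q) (mfderiv (𝓡 n) (𝓡 n) (extChartAt (𝓡 n) p) q v) =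
      α q v := by
  have h := congrArg (fun l => l v) (mfderiv_extChartAt_symm_comp hq)
  have e : (extChartAt (𝓡 n) p).symm (extChartAt (𝓡 n) p q) = q := (extChartAt (𝓡 n) p).left_inv hq
  have h2 : oneFormInChart α p (extChartAt (𝓡 n) p q)
      (mfderiv (𝓡 n) (𝓡 n) (extChartAt (𝓡 n) p) q v) =
      α ((extChartAt (𝓡 n) p).symm (extChartAt (𝓡 n) p q)) v :=
    congrArg (α ((extChartAt (𝓡 n) p).symm (extChartAt (𝓡 n) p q))) h
  rw [h2]
  -- The base point cannot be rewritten in the dependent type of `α`. All tangent spaces unfold to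
  -- the model space, so the equality is transported there.
  exact congrArg (fun q' => (show Model n →L[ℝ] ℝ from α q') v) e

theorem inChart_mfderiv (Ω : TwoForm n M) {p q : M}
    (hq : q ∈ (extChartAt (𝓡 n) p).source) (u v : Tan n q) :
    TwoForm.inChart Ω p (extChartAt (𝓡 n) p q)
      ![mfderiv (𝓡 n) (𝓡 n) (extChartAt (𝓡 n) p) q u,
        mfderiv (𝓡 n) (𝓡 n) (extChartAt (𝓡 n) p) q v] = Ω q ![u, v] := by
  have hu := congrArg (fun l => l u) (mfderiv_extChartAt_symm_comp hq)
  have hv := congrArg (fun l => l v) (mfderiv_extChartAt_symm_comp hq)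
  have e : (extChartAt (𝓡 n) p).symm (extChartAt (𝓡 n) p q) = q := (extChartAt (𝓡 n) p).left_inv hq
  have h2 : TwoForm.inChart Ω p (extChartAt (𝓡 n) p q)
      ![mfderiv (𝓡 n) (𝓡 n) (extChartAt (𝓡 n) p) q u,
        mfderiv (𝓡 n) (𝓡 n) (extChartAt (𝓡 n) p) q v] =
      Ω ((extChartAt (𝓡 n) p).symm (extChartAt (𝓡 n) p q)) ![u, v] :=
    (pullback_apply _ _ _ _ _).trans
      (congrArg₂ (fun a b => Ω ((extChartAt (𝓡 n) p).symm (extChartAt (𝓡 n) p q)) ![a, b]) hu hv)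
  rw [h2]
  exact congrArg (fun q' => (show Model n [⋀^Fin 2]→L[ℝ] ℝ from Ω q') ![u, v]) e

theorem fieldInChart_extChartAt (X : VField n M) {p q : M}
    (hq : q ∈ (extChartAt (𝓡 n) p).source) :
    fieldInChart X p (extChartAt (𝓡 n) p q) =
      mfderiv (𝓡 n) (𝓡 n) (extChartAt (𝓡 n) p) q (X q) := by
  have h := congrArg (fun l => l (X q)) (mfderiv_extChartAt_symm_comp hq)
  have e : (extChartAt (𝓡 n) p).symm (extChartAt (𝓡 n) p q) = q := (extChartAt (𝓡 n) p).left_inv hq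
  refine ((isInvertible_mfderiv_extChartAt_symm
    ((extChartAt (𝓡 n) p).map_source hq)).inverse_apply_eq).2 (Eq.trans ?_ h.symm)
  exact congrArg (fun q' => (show Model n from X q')) e

theorem isInvertible_mfderiv_extChartAt_of_mem {p q : M} (hq : q ∈ (extChartAt (𝓡 n) p).source) :
    (mfderiv (𝓡 n) (𝓡 n) (extChartAt (𝓡 n) p) q).IsInvertible := by
  have : IsManifold (𝓡 n) 1 M := isManifold_one
  exact isInvertible_mfderiv_extChartAt hq

/-- The Lie bracket of vector fields, read in a chart. -/
theorem mfderiv_extChartAt_mlieBracket (X Y : VField n M) (p : M) :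
    mfderiv (𝓡 n) (𝓡 n) (extChartAt (𝓡 n) p) p (VectorField.mlieBracket (𝓡 n) X Y p) =
      VectorField.lieBracket ℝ (fieldInChart X p) (fieldInChart Y p) (extChartAt (𝓡 n) p p) := by
  have e (Z : VField n M) : VectorField.mpullbackWithin (𝓡 n) (𝓡 n) (extChartAt (𝓡 n) p).symm Z
      (Set.range (𝓡 n)) = fieldInChart Z p := by
    rw [ModelWithCorners.range_eq_univ, VectorField.mpullbackWithin_univ]
    rfl
  -- The manifold bracket unfolds to a bracket within this set, which is everything as there is no
  -- boundary.
  have hs : (extChartAt (𝓡 n) p).symm ⁻¹' Set.univ ∩ Set.range (𝓡 n) = Set.univ := by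
    simp
  rw [← VectorField.lieBracketWithin_univ, ← hs, ← e X, ← e Y]
  exact (isInvertible_mfderiv_extChartAt_of_mem (mem_extChartAt_source p)).self_apply_inverse _

/-- The differential of a function, read in a chart. -/
theorem diff_apply {f : M → ℝ} {p : M} (hf : ContMDiffAt (𝓡 n) 𝓘(ℝ, ℝ) ∞ f p) (v : Tan n p) :
    diff (n := n) f p v = fderiv ℝ (fun y => f ((extChartAt (𝓡 n) p).symm y))
      (extChartAt (𝓡 n) p p) (mfderiv (𝓡 n) (𝓡 n) (extChartAt (𝓡 n) p) p v) := by
  have hp := mem_extChartAt_source (I := 𝓡 n) p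
  have hg : ContMDiffAt (𝓡 n) 𝓘(ℝ, ℝ) ∞ (fun y => f ((extChartAt (𝓡 n) p).symm y))
      (extChartAt (𝓡 n) p p) :=
    ((contMDiffAt_iff_contDiffAt_comp_symm hp).1 hf).contMDiffAt
  have hφ : MDifferentiableAt (𝓡 n) (𝓡 n) (extChartAt (𝓡 n) p) p :=
    (contMDiffAt_extChartAt (n := ∞)).mdifferentiableAt (by simp)
  have h := mfderiv_comp p (hg.mdifferentiableAt (by simp)) hφ
  have e : f =ᶠ[𝓝 p] (fun y => f ((extChartAt (𝓡 n) p).symm y)) ∘ (extChartAt (𝓡 n) p) := by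
    filter_upwards [extChartAt_source_mem_nhds (I := 𝓡 n) p] with q hq
    exact congrArg f ((extChartAt (𝓡 n) p).left_inv hq).symm
  rw [diff, e.mfderiv_eq, h, mfderiv_eq_fderiv]
  rfl

end Charts

/-! ### Smooth families of two-forms -/

section SmoothForms

variable {E : Type*} [NormedAddCommGroup E] [NormedSpace ℝ E]
  {V W : Type*} [NormedAddCommGroup V] [NormedSpace ℝ V] [NormedAddCommGroup W] [NormedSpace ℝ W]

variable (V) in
/-- Two-forms on a vector space as bilinear forms. -/
noncomputable def twoFormCurry : (V [⋀^Fin 2]→L[ℝ] ℝ) →L[ℝ] V →L[ℝ] V →L[ℝ] ℝ :=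
  (ContinuousLinearMap.compL ℝ V (V [⋀^Fin 1]→L[ℝ] ℝ) (V →L[ℝ] ℝ)
      ((ContinuousAlternatingMap.ofSubsingletonLIE (𝕜 := ℝ) (E := V) (F := ℝ)
        (0 : Fin 1)).symm.toContinuousLinearEquiv : _ →L[ℝ] _)).comp
    (ContinuousAlternatingMap.curryLeftLI (𝕜 := ℝ) (E := V) (F := ℝ) (n := 1)).toContinuousLinearMap

theorem twoFormCurry_apply (η : V [⋀^Fin 2]→L[ℝ] ℝ) (u v : V) :
    twoFormCurry V η u v = η ![u, v] := by
  change η _ = η _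
  congr 1
  ext i
  fin_cases i <;> rfl

theorem twoForm_ext {η θ : V [⋀^Fin 2]→L[ℝ] ℝ} (h : ∀ u v, η ![u, v] = θ ![u, v]) : η = θ := by
  ext f
  have e : f = ![f 0, f 1] := by ext i; fin_cases i <;> rfl
  rw [e]
  exact h _ _

theorem twoFormCurry_injective : Function.Injective (twoFormCurry V) := by
  intro η θ h
  refine twoForm_ext fun u v => ?_
  rw [← twoFormCurry_apply, ← twoFormCurry_apply, h]

theorem contDiff_twoFormCurry : ContDiff ℝ ∞ (twoFormCurry V) :=
  ContinuousLinearMap.contDiff (F := V →L[ℝ] V →L[ℝ] ℝ) _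

theorem contDiffAt_twoFormCurry {η : E → V [⋀^Fin 2]→L[ℝ] ℝ} {x : E → V} {y : E}
    (hη : ContDiffAt ℝ ∞ η y) (hx : ContDiffAt ℝ ∞ x y) :
    ContDiffAt ℝ ∞ (fun y => twoFormCurry V (η y) (x y)) y := by
  have hB : ContDiffAt ℝ ∞ (fun y => twoFormCurry V (η y)) y :=
    contDiff_twoFormCurry.contDiffAt.comp y hη
  exact hB.clm_apply hx

theorem contDiffAt_twoForm_apply {η : E → V [⋀^Fin 2]→L[ℝ] ℝ} {x z : E → V} {y : E}
    (hη : ContDiffAt ℝ ∞ η y) (hx : ContDiffAt ℝ ∞ x y) (hz : ContDiffAt ℝ ∞ z y) :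
    ContDiffAt ℝ ∞ (fun y => η y ![x y, z y]) y := by
  simp only [← twoFormCurry_apply]
  exact (contDiffAt_twoFormCurry hη hx).clm_apply hz

/-- The composition of a smooth family of two-forms with a smooth family of linear maps is
smooth. -/
theorem contDiffAt_twoForm_comp [FiniteDimensional ℝ V] {η : E → W [⋀^Fin 2]→L[ℝ] ℝ}
    {l : E → V →L[ℝ] W} {y : E} (hη : ContDiffAt ℝ ∞ η y) (hl : ContDiffAt ℝ ∞ l y) :
    ContDiffAt ℝ ∞ (fun y => (η y).compContinuousLinearMap (l y)) y := by
  have : FiniteDimensional ℝ (V [⋀^Fin 2]→L[ℝ] ℝ) :=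
    FiniteDimensional.of_injective (V₂ := V →L[ℝ] V →L[ℝ] ℝ)
      (twoFormCurry V : (V [⋀^Fin 2]→L[ℝ] ℝ) →ₗ[ℝ] V →L[ℝ] V →L[ℝ] ℝ) twoFormCurry_injective
  have hB : ContDiffAt ℝ ∞ (fun y => twoFormCurry W (η y)) y :=
    contDiff_twoFormCurry.contDiffAt.comp y hη
  have hf : ContDiffAt ℝ ∞ (fun y => (ContinuousLinearMap.compL ℝ V W ℝ).flip (l y)) y :=
    contDiffAt_const.clm_apply hl
  -- Currying is linear and injective in finite dimension, so smoothness can be tested on the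
  -- bilinear form η(l u, l v), a composition of smooth families of linear maps.
  refine contDiffAt_of_injective_clm (T := fun _ => twoFormCurry V) contDiffAt_const
    (hf.clm_comp (hB.clm_comp hl)) twoFormCurry_injective (Eventually.of_forall fun x => ?_)
  ext u v
  rw [twoFormCurry_apply]
  refine Eq.trans ?_ (twoFormCurry_apply (η x) (l x u) (l x v)).symm
  change η x _ = _
  congr 1
  ext i
  fin_cases i <;> rfl

end SmoothForms

/-! ### Smooth coframes of annihilators -/

section Coframe

variable {E V : Type*} [NormedAddCommGroup E] [NormedSpace ℝ E]
  [NormedAddCommGroup V] [NormedSpace ℝ V] [FiniteDimensional ℝ V]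

/-- The linear combination map of a finite family of vectors. -/
noncomputable def combination {ι : Type*} [Fintype ι] (v : ι → V) : (ι → ℝ) →L[ℝ] V :=
  ∑ i, (ContinuousLinearMap.proj (R := ℝ) (φ := fun _ : ι => ℝ) i).smulRight (v i)

omit [FiniteDimensional ℝ V] in
theorem combination_apply {ι : Type*} [Fintype ι] (v : ι → V) (c : ι → ℝ) :
    combination v c = ∑ i, c i • v i := by
  simp [combination]

omit [FiniteDimensional ℝ V] in
theorem contDiffAt_combination {ι : Type*} [Fintype ι] {v : ι → E → V} {y : E}
    (hv : ∀ i, ContDiffAt ℝ ∞ (v i) y) :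
    ContDiffAt ℝ ∞ (fun y => combination fun i => v i y) y := by
  refine ContDiffAt.sum fun i _ => ?_
  exact ((ContinuousLinearMap.smulRightL ℝ (ι → ℝ) V
    (ContinuousLinearMap.proj (R := ℝ) (φ := fun _ : ι => ℝ) i)).contDiff.contDiffAt).comp y (hv i)

/-- A smooth family of subspaces spanned by a smooth frame is locally the common kernel of
smooth independent covectors. -/
theorem exists_smooth_annihilating_coframe {d r : ℕ} (hd : Module.finrank ℝ V = d) {x : Fin r → E → V} {O : Set E} (hO : IsOpen O)
    (hx : ∀ i, ∀ y ∈ O, ContDiffAt ℝ ∞ (x i) y) {y₀ : E} (hy₀ : y₀ ∈ O)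
    (hli : LinearIndependent ℝ fun i => x i y₀) :
    ∃ O' ⊆ O, IsOpen O' ∧ y₀ ∈ O' ∧
      ∃ ε : Fin (d - r) → E → V →L[ℝ] ℝ,
        (∀ j, ∀ y ∈ O', ContDiffAt ℝ ∞ (ε j) y) ∧
        ∀ y ∈ O', LinearIndependent ℝ (fun j => ε j y) ∧
          ∀ v, v ∈ Submodule.span ℝ (Set.range fun i => x i y) ↔ ∀ j, ε j y v = 0 := by
  subst hd
  obtain ⟨C, hC⟩ := Submodule.exists_isCompl (Submodule.span ℝ (Set.range fun i => x i y₀))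
  have hr : Module.finrank ℝ (Submodule.span ℝ (Set.range fun i => x i y₀)) = r := by
    simpa using finrank_span_eq_card hli
  have hsum := Submodule.finrank_add_eq_of_isCompl hC
  have hCr : Module.finrank ℝ C = Module.finrank ℝ V - r := by omega
  let b : Module.Basis (Fin (Module.finrank ℝ V - r)) ℝ C := Module.finBasisOfFinrankEq ℝ C hCr
  have hbli : LinearIndependent ℝ (fun j => (b j : V)) :=
    b.linearIndependent.map' C.subtype C.ker_subtype
  have hbspan : Submodule.span ℝ (Set.range fun j => (b j : V)) ≤ C := by
    rw [Submodule.span_le]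
    rintro _ ⟨j, rfl⟩
    exact (b j).2
  -- The frame is completed by constant vectors spanning a complement at `y₀`. It remains a basis
  -- nearby, and the covectors wanted are its last d - r coordinate functions. The subtraction does
  -- not truncate, as r independent vectors exist.
  let v : Fin r ⊕ Fin (Module.finrank ℝ V - r) → E → V :=
    Sum.elim x fun j _ => (b j : V)
  have hv : ∀ t, ∀ y ∈ O, ContDiffAt ℝ ∞ (v t) y := by
    rintro (i | j) y hy
    · exact hx i y hy
    · exact contDiffAt_const
  have hvli : LinearIndependent ℝ fun t => v t y₀ := by
    have h := hli.sum_type hbli (hC.disjoint.mono_right hbspan)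
    have e : (fun t => v t y₀) = Sum.elim (fun i => x i y₀) fun j => (b j : V) := by
      ext t
      rcases t with i | j <;> rfl
    rw [e]
    exact h
  let G : E → ((Fin r ⊕ Fin (Module.finrank ℝ V - r)) → ℝ) →L[ℝ] V :=
    fun y => combination fun t => v t y
  have hG : ∀ y ∈ O, ContDiffAt ℝ ∞ G y := fun y hy => contDiffAt_combination fun t => hv t y hy
  have hGinj : Function.Injective (G y₀) := by
    rw [injective_iff_map_eq_zero]
    intro c hc
    rw [show G y₀ c = ∑ t, c t • v t y₀ from combination_apply _ _] at hc
    exact funext (Fintype.linearIndependent_iff.1 hvli c hc)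
  have hGinv : (G y₀).IsInvertible := by
    have hcard : Module.finrank ℝ ((Fin r ⊕ Fin (Module.finrank ℝ V - r)) → ℝ) =
        Module.finrank ℝ V := by
      simp only [Module.finrank_fintype_fun_eq_card, Fintype.card_sum, Fintype.card_fin]
      omega
    exact ⟨(LinearEquiv.ofInjectiveOfFinrankEq (G y₀).toLinearMap hGinj
      hcard).toContinuousLinearEquiv, by ext; rfl⟩
  refine ⟨O ∩ G ⁻¹' {l | l.IsInvertible}, Set.inter_subset_left, ?_, ⟨hy₀, hGinv⟩,
    fun j y => (ContinuousLinearMap.proj (R := ℝ)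
      (φ := fun _ : Fin r ⊕ Fin (Module.finrank ℝ V - r) => ℝ) (Sum.inr j)).comp
        (G y).inverse, ?_, ?_⟩
  · exact ContinuousOn.isOpen_inter_preimage
      (fun y hy => (hG y hy).continuousAt.continuousWithinAt) hO ContinuousLinearEquiv.isOpen
  · rintro j y ⟨hy, e, he⟩
    refine contDiffAt_const.clm_comp ?_
    have h0 := contDiffAt_map_inverse (n := ∞) e
    rw [he] at h0
    exact h0.comp y (hG y hy)
  · rintro y ⟨hy, hinv⟩
    have hGr (c) : (G y).inverse (G y c) = c := hinv.inverse_apply_self c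
    constructor
    · rw [Fintype.linearIndependent_iff]
      intro g hg j
      have h := congrArg (fun l : V →L[ℝ] ℝ => l (G y (Pi.single (Sum.inr j) 1))) hg
      simpa [hGr, Pi.single_apply] using h
    · intro u
      obtain ⟨c, rfl⟩ := hinv.surjective u
      simp only [ContinuousLinearMap.comp_apply, hGr, ContinuousLinearMap.proj_apply]
      have hGc : G y c = ∑ i, c (Sum.inl i) • x i y + ∑ j, c (Sum.inr j) • (b j : V) := by
        rw [show G y c = ∑ t, c t • v t y from combination_apply _ _, Fintype.sum_sum_type]
        rfl
      constructor
      · intro hu j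
        obtain ⟨d, hd⟩ := (Submodule.mem_span_range_iff_exists_fun ℝ).1 hu
        have : G y (Sum.elim d 0) = G y c := by
          rw [← hd, show G y (Sum.elim d 0) = ∑ t, Sum.elim d 0 t • v t y from combination_apply _ _,
            Fintype.sum_sum_type]
          simp [v]
        rw [← hinv.injective this]
        rfl
      · intro h
        rw [hGc]
        simp only [h, zero_smul, Finset.sum_const_zero, add_zero]
        exact Submodule.sum_mem _ fun i _ =>
          Submodule.smul_mem _ _ (Submodule.subset_span ⟨i, rfl⟩)

end Coframe

/-! ### Linear algebra of S and Λ^♯ at a point -/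

section Pointwise

variable {n k : ℕ} {M : Type*} [TopologicalSpace M] [ChartedSpace (Model n) M]
  {Ω : Fin k → TwoForm n M} {D : (p : M) → Submodule ℝ (Tan n p)}

theorem flat_apply (η : TwoForm n M) (p : M) (u v : Tan n p) :
    TwoForm.flat η p u v = η p ![u, v] := rfl

/-- The vanishing condition says exactly that X is in D^⊥(p). This is the form in which the
transversality hypothesis enters all later arguments. -/
theorem eq_zero_of_flat_eq_zero {p : M} (hperp : D p ⊓ orthogonal Ω D p = ⊥) {X : Tan n p}
    (hX : X ∈ D p) (h : ∀ A, ∀ w ∈ D p, TwoForm.flat (Ω A) p X w = 0) : X = 0 := by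
  have hmem : X ∈ D p ⊓ orthogonal Ω D p := by
    refine ⟨hX, ?_⟩
    exact (Submodule.mem_iInf _).2 fun A => Submodule.mem_comap.2 (h A)
  rw [hperp] at hmem
  exact (Submodule.mem_bot ℝ).1 hmem

/-- Uniqueness of the vector attached to an element of S(p); it makes the choice in `diracSharp`
additive and homogeneous. -/
theorem eq_of_flat_eq {p : M} (hperp : D p ⊓ orthogonal Ω D p = ⊥) {X Y : Tan n p}
    (hX : X ∈ D p) (hY : Y ∈ D p)
    (h : ∀ A, ∀ w ∈ D p, TwoForm.flat (Ω A) p X w = TwoForm.flat (Ω A) p Y w) : X = Y := by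
  rw [← sub_eq_zero]
  refine eq_zero_of_flat_eq_zero hperp ((D p).sub_mem hX hY) fun A w hw => ?_
  rw [map_sub, sub_apply, h A w hw, sub_self]

/-- The map `Λ^♯ : S(p) → T_p M` sending `α` to the unique `X ∈ D(p)` with
`α|_{D(p)} = Ω^♭(X)|_{D(p)}`. -/
noncomputable def diracSharp (hperp : ∀ p : M, D p ⊓ orthogonal Ω D p = ⊥) (p : M) :
    diracS Ω D p →ₗ[ℝ] Tan n p where
  toFun α := α.2.choose
  map_add' α β := by
    have hα := α.2.choose_spec
    have hβ := β.2.choose_spec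
    have h := (α + β).2.choose_spec
    refine eq_of_flat_eq (hperp p) h.1 ((D p).add_mem hα.1 hβ.1) fun A w hw => ?_
    rw [map_add, add_apply, ← h.2 A w hw, ← hα.2 A w hw, ← hβ.2 A w hw]
    rfl
  map_smul' c α := by
    have hα := α.2.choose_spec
    have h := (c • α).2.choose_spec
    refine eq_of_flat_eq (hperp p) h.1 ((D p).smul_mem c hα.1) fun A w hw => ?_
    rw [RingHom.id_apply, map_smul, smul_apply, ← h.2 A w hw, ← hα.2 A w hw]
    rfl

variable (hperp : ∀ p : M, D p ⊓ orthogonal Ω D p = ⊥)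

theorem diracSharp_mem (p : M) (α : diracS Ω D p) : diracSharp hperp p α ∈ D p :=
  α.2.choose_spec.1

theorem flat_diracSharp (p : M) (α : diracS Ω D p) (A : Fin k) {w : Tan n p} (hw : w ∈ D p) :
    TwoForm.flat (Ω A) p (diracSharp hperp p α) w = α.1 A w :=
  (α.2.choose_spec.2 A w hw).symm

theorem diracSharp_eq_iff (p : M) (α : diracS Ω D p) (X : Tan n p) :
    diracSharp hperp p α = X ↔
      X ∈ D p ∧ ∀ A, ∀ w ∈ D p, TwoForm.flat (Ω A) p X w = α.1 A w := by
  constructor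
  · rintro rfl
    exact ⟨diracSharp_mem hperp p α, fun A w hw => flat_diracSharp hperp p α A hw⟩
  · rintro ⟨hX, h⟩
    refine eq_of_flat_eq (hperp p) (diracSharp_mem hperp p α) hX fun A w hw => ?_
    rw [h A w hw, flat_diracSharp hperp p α A hw]

/-- For X in D(p) the tuple ω^♭(X) itself belongs to S(p), with X as its witness. -/
theorem range_diracSharp (p : M) : LinearMap.range (diracSharp hperp p) = D p := by
  refine le_antisymm ?_ fun X hX => ?_
  · rintro _ ⟨α, rfl⟩
    exact diracSharp_mem hperp p α
  · exact ⟨⟨fun A => TwoForm.flat (Ω A) p X, X, hX, fun _ _ _ => rfl⟩,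
      (diracSharp_eq_iff hperp p _ X).2 ⟨hX, fun _ _ _ => rfl⟩⟩

theorem flat_self (η : TwoForm n M) (p : M) (u : Tan n p) : TwoForm.flat η p u u = 0 :=
  (η p).map_eq_zero_of_eq ![u, u] (i := 0) (j := 1) rfl (by decide)

/-- The frame of `S(p)` built from a frame `X` of `D(p)` and a frame `ε` of its annihilator. -/
noncomputable def diracFrame (Ω : Fin k → TwoForm n M) {r s : ℕ} (p : M) (X : Fin r → Tan n p)
    (ε : Fin s → Cotan n p) : Fin r ⊕ (Fin s × Fin k) → Covel n k p :=
  Sum.elim (fun i A => TwoForm.flat (Ω A) p (X i)) fun jB => Pi.single jB.2 (ε jB.1)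

/-- Only the annihilator covectors placed in slot A contribute to component A. -/
theorem sum_smul_diracFrame {r s : ℕ} {p : M} (X : Fin r → Tan n p) (ε : Fin s → Cotan n p)
    (g : Fin r ⊕ (Fin s × Fin k) → ℝ) (A : Fin k) :
    (∑ t, g t • diracFrame Ω p X ε t) A =
      TwoForm.flat (Ω A) p (∑ i, g (Sum.inl i) • X i) + ∑ j, g (Sum.inr (j, A)) • ε j := by
  rw [Fintype.sum_sum_type, Pi.add_apply, Finset.sum_apply, Finset.sum_apply, map_sum]
  congr 1
  · refine Finset.sum_congr rfl fun i _ => ?_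
    rw [map_smul]
    rfl
  · rw [Fintype.sum_prod_type]
    refine Finset.sum_congr rfl fun j _ => ?_
    rw [Finset.sum_eq_single A]
    · simp [diracFrame]
    · intro B _ hB
      simp [diracFrame, hB.symm]
    · simp

/-- Restricting a linear relation to D kills the ε part, so transversality makes the combination of
the X_i vanish; in each slot there remains a relation among the ε_j. -/
theorem linearIndependent_diracFrame {r s : ℕ} {p : M} (hperp : D p ⊓ orthogonal Ω D p = ⊥)
    {X : Fin r → Tan n p} {ε : Fin s → Cotan n p} (hX : LinearIndependent ℝ X)
    (hXD : Submodule.span ℝ (Set.range X) = D p) (hε : LinearIndependent ℝ ε)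
    (hεD : ∀ v, v ∈ D p ↔ ∀ j, ε j v = 0) : LinearIndependent ℝ (diracFrame Ω p X ε) := by
  rw [Fintype.linearIndependent_iff]
  intro g hg
  have hA (A : Fin k) := (sum_smul_diracFrame X ε g A).symm.trans (congrFun hg A)
  have hmem : ∑ i, g (Sum.inl i) • X i ∈ D p := by
    rw [← hXD]
    exact Submodule.sum_mem _ fun i _ => Submodule.smul_mem _ _ (Submodule.subset_span ⟨i, rfl⟩)
  have hzero : ∑ i, g (Sum.inl i) • X i = 0 := by
    refine eq_zero_of_flat_eq_zero hperp hmem fun A w hw => ?_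
    have h := congrArg (fun l : Cotan n p => l w) (hA A)
    have hw' : (∑ j, g (Sum.inr (j, A)) • ε j) w = 0 := by
      rw [sum_apply]
      exact Finset.sum_eq_zero fun j _ => by rw [smul_apply, (hεD w).1 hw j, smul_zero]
    simpa [hw'] using h
  rintro (i | ⟨j, A⟩)
  · exact Fintype.linearIndependent_iff.1 hX _ hzero i
  · have h := hA A
    rw [hzero, map_zero, zero_add] at h
    exact Fintype.linearIndependent_iff.1 hε (fun j => g (Sum.inr (j, A))) h j

/-- A functional vanishing on the common kernel of finitely many others is a combination of them;
this carries the algebraic fact over to continuous functionals. -/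
theorem mem_span_of_forall_eq_zero {V : Type*} [AddCommGroup V] [TopologicalSpace V] [Module ℝ V]
    {s : ℕ} {ε : Fin s → V →L[ℝ] ℝ} {l : V →L[ℝ] ℝ} (h : ∀ v, (∀ j, ε j v = 0) → l v = 0) :
    ∃ c : Fin s → ℝ, l = ∑ j, c j • ε j := by
  have hmem : l.toLinearMap ∈ Submodule.span ℝ (Set.range fun j => (ε j).toLinearMap) := by
    refine mem_span_of_iInf_ker_le_ker fun v hv => h v fun j => ?_
    exact (Submodule.mem_iInf _).1 hv j
  obtain ⟨c, hc⟩ := (Submodule.mem_span_range_iff_exists_fun ℝ).1 hmem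
  refine ⟨c, ContinuousLinearMap.ext fun v => ?_⟩
  simpa using (LinearMap.congr_fun hc v).symm

/-- If Y is the witness for α, each component of α - ω^♭(Y) annihilates D, hence is a combination of
the ε_j with coefficients depending on the slot. -/
theorem span_diracFrame {r s : ℕ} {p : M}
    {X : Fin r → Tan n p} {ε : Fin s → Cotan n p}
    (hXD : Submodule.span ℝ (Set.range X) = D p)
    (hεD : ∀ v, v ∈ D p ↔ ∀ j, ε j v = 0) :
    Submodule.span ℝ (Set.range (diracFrame Ω p X ε)) = diracS Ω D p := by
  refine le_antisymm ?_ ?_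
  · rw [Submodule.span_le]
    rintro _ ⟨i | ⟨j, B⟩, rfl⟩
    · exact ⟨X i, hXD ▸ Submodule.subset_span ⟨i, rfl⟩, fun _ _ _ => rfl⟩
    · refine ⟨0, (D p).zero_mem, fun A w hw => ?_⟩
      rw [map_zero]
      rcases eq_or_ne A B with rfl | h
      · simpa [diracFrame] using (hεD w).1 hw j
      · simp [diracFrame, h]
  · rintro α ⟨Y, hY, h⟩
    rw [← hXD] at hY
    obtain ⟨c, rfl⟩ := (Submodule.mem_span_range_iff_exists_fun ℝ).1 hY
    have hd (A : Fin k) := mem_span_of_forall_eq_zero (ε := ε)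
      (l := α A - TwoForm.flat (Ω A) p (∑ i, c i • X i)) fun v hv => by
        rw [sub_apply, h A v ((hεD v).2 hv), sub_self]
    choose d hd using hd
    rw [Submodule.mem_span_range_iff_exists_fun]
    refine ⟨Sum.elim c fun jA => d jA.2 jA.1, ?_⟩
    ext A : 1
    rw [sum_smul_diracFrame]
    simp only [Sum.elim_inl, Sum.elim_inr]
    rw [← hd A]
    abel

end Pointwise

/-- Covectors cutting out a subspace, pulled back under a linear isomorphism. -/
theorem annihilating_coframe_comp {V W ι : Type*} [AddCommGroup V] [TopologicalSpace V]
    [Module ℝ V] [AddCommGroup W] [TopologicalSpace W] [Module ℝ W] {J : V →L[ℝ] W}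
    (hJ : J.IsInvertible) {X : ι → V} {x : ι → W} (hx : ∀ i, x i = J (X i)) {s : ℕ}
    {ε : Fin s → W →L[ℝ] ℝ} (hε : LinearIndependent ℝ ε)
    (h : ∀ w, w ∈ Submodule.span ℝ (Set.range x) ↔ ∀ j, ε j w = 0) :
    LinearIndependent ℝ (fun j => (ε j).comp J) ∧
      ∀ v, v ∈ Submodule.span ℝ (Set.range X) ↔ ∀ j, (ε j).comp J v = 0 := by
  constructor
  · rw [Fintype.linearIndependent_iff] at hε ⊢
    intro g hg
    refine hε g (ContinuousLinearMap.ext fun v => ?_)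
    obtain ⟨w, rfl⟩ := hJ.surjective v
    simpa using congrArg (fun l : V →L[ℝ] ℝ => l w) hg
  · intro v
    have e : Set.range x = J.toLinearMap '' Set.range X := by
      rw [← Set.range_comp]
      exact congrArg Set.range (funext hx)
    refine Iff.trans ?_ (h (J v))
    rw [e, Submodule.span_image]
    exact (Function.Injective.mem_set_image hJ.injective).symm

/-! ### Smoothness of S and of Λ^♯ -/

section Bundle

variable {n k r : ℕ} {M : Type*} [TopologicalSpace M] [ChartedSpace (Model n) M]
  [IsManifold (𝓡 n) ∞ M] {Ω : Fin k → TwoForm n M} {D : (p : M) → Submodule ℝ (Tan n p)}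

omit [IsManifold (𝓡 n) ∞ M] in
theorem contDiffAt_inChart {η : TwoForm n M} (hη : TwoForm.IsSmooth η) {p : M} {y : Model n}
    (hy : y ∈ (extChartAt (𝓡 n) p).target) : ContDiffAt ℝ ∞ (TwoForm.inChart η p) y :=
  (hη p y hy).contDiffAt (extChartAt_target_mem_nhds_of_mem hy)

/-- The contraction of a smooth two-form with a smooth field is smooth. -/
theorem contDiffAt_oneFormInChart_flat {η : TwoForm n M} (hη : TwoForm.IsSmooth η)
    {X : VField n M} {p : M} {y : Model n} (hy : y ∈ (extChartAt (𝓡 n) p).target)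
    (hX : ContDiffAt ℝ ∞ (fieldInChart X p) y) :
    ContDiffAt ℝ ∞ (oneFormInChart (fun q => TwoForm.flat η q (X q)) p) y := by
  refine (contDiffAt_twoFormCurry (contDiffAt_inChart hη hy) hX).congr_of_eventuallyEq ?_
  filter_upwards [extChartAt_target_mem_nhds_of_mem hy] with z hz
  ext v
  rw [twoFormCurry_apply]
  refine Eq.trans ?_ (pullback_apply (a := n) (extChartAt (𝓡 n) p).symm η z
    (fieldInChart X p z) v).symm
  rw [mfderiv_symm_fieldInChart X hz]
  rfl

omit [IsManifold (𝓡 n) ∞ M] in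
theorem isOpen_chart_inter_preimage {U : Set M} (hU : IsOpen U) (p : M) :
    IsOpen ((extChartAt (𝓡 n) p).target ∩ (extChartAt (𝓡 n) p).symm ⁻¹' U) :=
  (continuousOn_extChartAt_symm p).isOpen_inter_preimage (isOpen_extChartAt_target p) hU

/-- A regular distribution has, near each point, a smooth frame and a smooth frame of its
annihilator. -/
theorem IsRegularDistribution.exists_adapted_coframe (hD : IsRegularDistribution D r) (p : M) :
    ∃ U : Set M, IsOpen U ∧ p ∈ U ∧ ∃ (X : Fin r → VField n M)
      (ε : Fin (n - r) → (q : M) → Cotan n q),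
      U ⊆ (extChartAt (𝓡 n) p).source ∧
      (∀ i, SmoothFieldOn (X i) U) ∧
      (∀ j, ∀ q ∈ U, ContDiffAt ℝ ∞ (oneFormInChart (ε j) p) (extChartAt (𝓡 n) p q)) ∧
      ∀ q ∈ U, LinearIndependent ℝ (fun i => X i q) ∧
        Submodule.span ℝ (Set.range fun i => X i q) = D q ∧
        LinearIndependent ℝ (fun j => ε j q) ∧ ∀ v, v ∈ D q ↔ ∀ j, ε j q v = 0 := by
  obtain ⟨U, hU, hpU, X, hX, hXD⟩ := hD p
  have hp := mem_extChartAt_source (I := 𝓡 n) p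
  have hxs : ∀ i, ∀ y ∈ (extChartAt (𝓡 n) p).target ∩ (extChartAt (𝓡 n) p).symm ⁻¹' U,
      ContDiffAt ℝ ∞ (fieldInChart (X i) p) y := by
    rintro i y ⟨hy, hyU⟩
    have h := (hX i).contDiffAt hU ((extChartAt (𝓡 n) p).map_target hy) hyU
    rwa [(extChartAt (𝓡 n) p).right_inv hy] at h
  have hker (q : M) (hq : q ∈ (extChartAt (𝓡 n) p).source) :
      LinearMap.ker (mfderiv (𝓡 n) (𝓡 n) (extChartAt (𝓡 n) p) q).toLinearMap = ⊥ :=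
    LinearMap.ker_eq_bot.2 (isInvertible_mfderiv_extChartAt_of_mem hq).injective
  have hxeq (q : M) (hq : q ∈ (extChartAt (𝓡 n) p).source) :
      (fun i => fieldInChart (X i) p (extChartAt (𝓡 n) p q)) =
        (mfderiv (𝓡 n) (𝓡 n) (extChartAt (𝓡 n) p) q).toLinearMap ∘ fun i => X i q :=
    funext fun i => fieldInChart_extChartAt (X i) hq
  have hli : LinearIndependent ℝ fun i => fieldInChart (X i) p (extChartAt (𝓡 n) p p) := by
    rw [hxeq p hp]
    exact (hXD p hpU).1.map' _ (hker p hp)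
  -- The coframe is constructed in the chart and then pulled back by the differential of the chart.
  obtain ⟨O, hOsub, hO, hpO, ε, hε, hεO⟩ := exists_smooth_annihilating_coframe
    (show Module.finrank ℝ (Model n) = n by simp) (isOpen_chart_inter_preimage hU p) hxs
    ⟨mem_extChartAt_target p, by
      change (extChartAt (𝓡 n) p).symm (extChartAt (𝓡 n) p p) ∈ U
      rwa [(extChartAt (𝓡 n) p).left_inv hp]⟩ hli
  refine ⟨(extChartAt (𝓡 n) p).source ∩ extChartAt (𝓡 n) p ⁻¹' O,
    (continuousOn_extChartAt p).isOpen_inter_preimage (isOpen_extChartAt_source p) hO,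
    ⟨hp, hpO⟩, X, fun j q => (ε j (extChartAt (𝓡 n) p q)).comp
      (mfderiv (𝓡 n) (𝓡 n) (extChartAt (𝓡 n) p) q), Set.inter_subset_left, ?_, ?_, ?_⟩
  · refine fun i => (hX i).mono ?_
    rintro q ⟨hq, hqO⟩
    have h := (hOsub hqO).2
    change (extChartAt (𝓡 n) p).symm (extChartAt (𝓡 n) p q) ∈ U at h
    rwa [(extChartAt (𝓡 n) p).left_inv hq] at h
  · rintro j q ⟨hq, hqO⟩
    refine (hε j _ hqO).congr_of_eventuallyEq ?_
    filter_upwards [extChartAt_target_mem_nhds_of_mem ((extChartAt (𝓡 n) p).map_source hq)]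
      with y hy
    ext v
    obtain ⟨w, rfl⟩ := (isInvertible_mfderiv_extChartAt_of_mem
      ((extChartAt (𝓡 n) p).map_target hy)).surjective v
    have h := oneFormInChart_mfderiv (fun q => (ε j (extChartAt (𝓡 n) p q)).comp
      (mfderiv (𝓡 n) (𝓡 n) (extChartAt (𝓡 n) p) q)) ((extChartAt (𝓡 n) p).map_target hy) w
    rw [(extChartAt (𝓡 n) p).right_inv hy] at h
    refine h.trans ?_
    rw [(extChartAt (𝓡 n) p).right_inv hy]
    rfl
  · rintro q ⟨hq, hqO⟩
    have hqU : q ∈ U := by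
      have h := (hOsub hqO).2
      change (extChartAt (𝓡 n) p).symm (extChartAt (𝓡 n) p q) ∈ U at h
      rwa [(extChartAt (𝓡 n) p).left_inv hq] at h
    have hJ := isInvertible_mfderiv_extChartAt_of_mem hq
    have h := annihilating_coframe_comp hJ (X := fun i => X i q)
      (fun i => fieldInChart_extChartAt (X i) hq) (hεO _ hqO).1 (hεO _ hqO).2
    exact ⟨(hXD q hqU).1, (hXD q hqU).2, h.1, fun v => (hXD q hqU).2 ▸ h.2 v⟩

variable (hΩ : ∀ A, TwoForm.IsSmooth (Ω A)) (hD : IsRegularDistribution D r)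
  (hperp : ∀ p : M, D p ⊓ orthogonal Ω D p = ⊥)

include hD hperp in
theorem finrank_diracS (p : M) : Module.finrank ℝ (diracS Ω D p) = r + (n - r) * k := by
  obtain ⟨U, -, hpU, X, ε, -, -, -, h⟩ := hD.exists_adapted_coframe p
  obtain ⟨hX, hXD, hε, hεD⟩ := h p hpU
  rw [← span_diracFrame (Ω := Ω) hXD hεD,
    finrank_span_eq_card (linearIndependent_diracFrame (hperp p) hX hXD hε hεD)]
  simp

include hΩ hD hperp in
theorem isSubbundle_diracS : IsSubbundle (diracS Ω D) := by
  intro p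
  obtain ⟨U, hU, hpU, X, ε, hUs, hX, hε, h⟩ := hD.exists_adapted_coframe p
  let e : Fin (Fintype.card (Fin r ⊕ (Fin (n - r) × Fin k))) ≃ Fin r ⊕ (Fin (n - r) × Fin k) :=
    (Fintype.equivFin _).symm
  refine ⟨U, hU, hpU, _, fun t q => diracFrame Ω q (fun i => X i q) (fun j => ε j q) (e t),
    ?_, ?_⟩
  · intro t A q hq
    refine ContMDiffAt.contMDiffWithinAt ?_
    rw [contMDiffAt_oneForm_iff (hUs hq)]
    have hy := (extChartAt (𝓡 n) p).map_source (hUs hq)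
    suffices H : ∀ t, ContDiffAt ℝ ∞ (oneFormInChart (fun q => diracFrame Ω q (fun i => X i q)
        (fun j => ε j q) t A) p) (extChartAt (𝓡 n) p q) from H (e t)
    rintro (i | ⟨j, B⟩)
    · exact contDiffAt_oneFormInChart_flat (hΩ A) hy ((hX i).contDiffAt hU (hUs hq) hq)
    · rcases eq_or_ne A B with rfl | hAB
      · have h1 : (fun q => diracFrame Ω q (fun i => X i q) (fun j => ε j q) (Sum.inr (j, A)) A) =
            ε j := funext fun q => Pi.single_eq_same _ _
        rw [h1]
        exact hε j q hq
      · have h1 : (fun q => diracFrame Ω q (fun i => X i q) (fun j => ε j q) (Sum.inr (j, B)) A) =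
            fun _ => 0 := funext fun q => Pi.single_eq_of_ne hAB _
        rw [h1]
        exact contDiffAt_const (c := (0 : Model n →L[ℝ] ℝ))
  · intro q hq
    obtain ⟨hXq, hXD, hεq, hεD⟩ := h q hq
    refine ⟨(linearIndependent_diracFrame (hperp q) hXq hXD hεq hεD).comp _ e.injective, ?_⟩
    rw [← span_diracFrame (Ω := Ω) hXD hεD]
    congr 1
    exact e.surjective.range_comp _

omit [IsManifold (𝓡 n) ∞ M] in
theorem sharp_of_mem {S : (p : M) → Submodule ℝ (Covel n k p)} (Λ : (p : M) → S p →ₗ[ℝ] Tan n p)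
    (α : (p : M) → Covel n k p) {p : M} (h : α p ∈ S p) : sharp Λ α p = Λ p ⟨α p, h⟩ :=
  dif_pos h

include hΩ hD in
/-- `Λ^♯` maps smooth sections of `S` to smooth vector fields. -/
theorem smoothFieldOn_sharp {U : Set M} (hU : IsOpen U) {α : (p : M) → Covel n k p}
    (hα : SmoothCovelOn α U) (hαS : ∀ p ∈ U, α p ∈ diracS Ω D p) :
    SmoothFieldOn (sharp (diracSharp hperp) α) U := by
  intro p hpU
  refine ContMDiffAt.contMDiffWithinAt ?_
  have hp := mem_extChartAt_source (I := 𝓡 n) p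
  rw [contMDiffAt_field_iff hp]
  obtain ⟨U', hU', hpU', X, hX, hXD⟩ := hD p
  have hy₀ := mem_extChartAt_target (I := 𝓡 n) p
  have hx (i) := (hX i).contDiffAt hU' hp hpU'
  have hη (A) := contDiffAt_inChart (hΩ A) hy₀
  -- The coefficients are chosen pointwise, without regularity; their smoothness comes from the
  -- linear system they solve.
  have hcoeff : ∀ q ∈ U ∩ U', ∃ c : Fin r → ℝ,
      ∑ i, c i • X i q = sharp (diracSharp hperp) α q := by
    rintro q ⟨hq, hq'⟩
    rw [← Submodule.mem_span_range_iff_exists_fun, (hXD q hq').2, sharp_of_mem _ _ (hαS q hq)]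
    exact diracSharp_mem hperp q _
  choose! c hc using hcoeff
  -- The matrix has entries ω_A(X_i, X_j): kr equations, indexed by (A, j), in r unknowns. The
  -- right-hand side is α_A(X_j).
  let T : Model n → (Fin r → ℝ) →L[ℝ] (Fin k × Fin r → ℝ) := fun y =>
    combination fun i Aj => TwoForm.inChart (Ω Aj.1) p y
      ![fieldInChart (X i) p y, fieldInChart (X Aj.2) p y]
  have hT : ContDiffAt ℝ ∞ T (extChartAt (𝓡 n) p p) :=
    contDiffAt_combination fun i => contDiffAt_pi.2 fun Aj =>
      contDiffAt_twoForm_apply (hη Aj.1) (hx i) (hx Aj.2)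
  have hg : ContDiffAt ℝ ∞ (fun y => fun Aj : Fin k × Fin r =>
      oneFormInChart (fun q => α q Aj.1) p y (fieldInChart (X Aj.2) p y))
      (extChartAt (𝓡 n) p p) :=
    contDiffAt_pi.2 fun Aj => (hα.contDiffAt hU hp hpU Aj.1).clm_apply (hx Aj.2)
  have hTeq : ∀ y ∈ (extChartAt (𝓡 n) p).target, ∀ (d : Fin r → ℝ) (A : Fin k) (j : Fin r),
      T y d (A, j) = TwoForm.flat (Ω A) ((extChartAt (𝓡 n) p).symm y)
        (∑ i, d i • X i ((extChartAt (𝓡 n) p).symm y)) (X j ((extChartAt (𝓡 n) p).symm y)) := by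
    intro y hy d A j
    rw [show T y d = _ from combination_apply _ _, Finset.sum_apply, map_sum, sum_apply]
    refine Finset.sum_congr rfl fun i _ => ?_
    rw [map_smul, smul_apply, flat_apply, ← inChart_fieldInChart _ _ _ hy]
    rfl
  have hnear : ∀ᶠ y in 𝓝 (extChartAt (𝓡 n) p p), y ∈ (extChartAt (𝓡 n) p).target ∧
      (extChartAt (𝓡 n) p).symm y ∈ U ∩ U' := by
    refine (isOpen_chart_inter_preimage (hU.inter hU') p).mem_nhds ⟨hy₀, ?_⟩
    change (extChartAt (𝓡 n) p).symm (extChartAt (𝓡 n) p p) ∈ U ∩ U'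
    rw [(extChartAt (𝓡 n) p).left_inv hp]
    exact ⟨hpU, hpU'⟩
  have hnear₀ := hnear.self_of_nhds
  have hXmem : ∀ q ∈ U', ∀ j, X j q ∈ D q := fun q hq j =>
    (hXD q hq).2 ▸ Submodule.subset_span ⟨j, rfl⟩
  -- A vector of the kernel gives an element of D orthogonal to every X_j for all ω_A, hence to D.
  have hinj : Function.Injective (T (extChartAt (𝓡 n) p p)) := by
    rw [injective_iff_map_eq_zero]
    intro d hd
    have hmem := (hXD _ hnear₀.2.2).2
    have h0 : ∑ i, d i • X i ((extChartAt (𝓡 n) p).symm (extChartAt (𝓡 n) p p)) = 0 := by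
      refine eq_zero_of_flat_eq_zero (hperp _) ?_ fun A w hw => ?_
      · exact Submodule.sum_mem _ fun i _ => Submodule.smul_mem _ _ (hXmem _ hnear₀.2.2 i)
      · rw [← hmem] at hw
        induction hw using Submodule.span_induction with
        | mem w hw =>
          obtain ⟨j, rfl⟩ := hw
          rw [← hTeq _ hy₀, hd]
          rfl
        | zero => exact map_zero _
        | add u v _ _ hu hv => rw [map_add, hu, hv, add_zero]
        | smul a u _ hu => rw [map_smul, hu, smul_zero]
    exact funext (Fintype.linearIndependent_iff.1 (hXD _ hnear₀.2.2).1 d h0)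
  have hcs : ContDiffAt ℝ ∞ (fun y => c ((extChartAt (𝓡 n) p).symm y)) (extChartAt (𝓡 n) p p) := by
    refine contDiffAt_of_injective_clm hT hg hinj ?_
    filter_upwards [hnear] with y hy
    ext ⟨A, j⟩
    rw [hTeq y hy.1, hc _ hy.2, sharp_of_mem _ _ (hαS _ hy.2.1),
      flat_diracSharp hperp _ _ _ (hXmem _ hy.2.2 j), oneFormInChart_fieldInChart _ _ hy.1]
  have hsum : ContDiffAt ℝ ∞ (fun y => ∑ i, c ((extChartAt (𝓡 n) p).symm y) i •
      fieldInChart (X i) p y) (extChartAt (𝓡 n) p p) :=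
    ContDiffAt.sum fun i _ => (contDiffAt_pi.1 hcs i).smul (hx i)
  refine hsum.congr_of_eventuallyEq ?_
  filter_upwards [hnear] with y hy
  refine ((isInvertible_mfderiv_extChartAt_symm hy.1).inverse_apply_eq).2 ?_
  rw [← hc _ hy.2]
  refine Eq.trans ?_ (map_sum (mfderiv (𝓡 n) (𝓡 n) (extChartAt (𝓡 n) p).symm y) _ _).symm
  refine Finset.sum_congr rfl fun i _ => ?_
  refine Eq.trans ?_ (map_smul (mfderiv (𝓡 n) (𝓡 n) (extChartAt (𝓡 n) p).symm y) _ _).symm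
  rw [mfderiv_symm_fieldInChart _ hy.1]

end Bundle

/-! ### Integrability of Λ^♯ -/

section Integrability

variable {n k r : ℕ} {M : Type*} [TopologicalSpace M] [ChartedSpace (Model n) M]
  [IsManifold (𝓡 n) ∞ M] {Ω : Fin k → TwoForm n M} {D : (p : M) → Submodule ℝ (Tan n p)}

/-- On sections of an involutive distribution on which `α`, `β` agree with `η(X, ·)`, `η(Y, ·)`,
`η` closed, the one-form `L_X β - L_Y α - d(β(X))` agrees with `η([X, Y], ·)`. -/
theorem lieDeriv_bracket_apply {η : TwoForm n M} (hη : TwoForm.IsSmooth η)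
    (hclosed : TwoForm.IsClosed η) (hinv : IsInvolutive D) {U : Set M} (hU : IsOpen U)
    {X Y Z : VField n M} (hX : SmoothFieldOn X U) (hY : SmoothFieldOn Y U)
    (hZ : SmoothFieldOn Z U) (hXD : ∀ q ∈ U, X q ∈ D q) (hYD : ∀ q ∈ U, Y q ∈ D q)
    (hZD : ∀ q ∈ U, Z q ∈ D q) {α β : (q : M) → Cotan n q} {p : M} (hpU : p ∈ U)
    (hα : ContDiffAt ℝ ∞ (oneFormInChart α p) (extChartAt (𝓡 n) p p))
    (hβ : ContDiffAt ℝ ∞ (oneFormInChart β p) (extChartAt (𝓡 n) p p))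
    (hαX : ∀ q ∈ U, ∀ w ∈ D q, α q w = TwoForm.flat η q (X q) w)
    (hβY : ∀ q ∈ U, ∀ w ∈ D q, β q w = TwoForm.flat η q (Y q) w) :
    (lieDeriv X β p - lieDeriv Y α p - diff (fun q => β q (X q)) p : Cotan n p) (Z p) =
      TwoForm.flat η p (VectorField.mlieBracket (𝓡 n) X Y p) (Z p) := by
  have hp := mem_extChartAt_source (I := 𝓡 n) p
  have hy₀ := mem_extChartAt_target (I := 𝓡 n) p
  have hnear : ∀ᶠ y in 𝓝 (extChartAt (𝓡 n) p p), y ∈ (extChartAt (𝓡 n) p).target ∧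
      (extChartAt (𝓡 n) p).symm y ∈ U := by
    refine (isOpen_chart_inter_preimage hU p).mem_nhds ⟨hy₀, ?_⟩
    change (extChartAt (𝓡 n) p).symm (extChartAt (𝓡 n) p p) ∈ U
    rwa [(extChartAt (𝓡 n) p).left_inv hp]
  have hx := hX.contDiffAt hU hp hpU
  have hy := hY.contDiffAt hU hp hpU
  have hz := hZ.contDiffAt hU hp hpU
  have hβX : (fun y => β ((extChartAt (𝓡 n) p).symm y) (X ((extChartAt (𝓡 n) p).symm y)))
      =ᶠ[𝓝 (extChartAt (𝓡 n) p p)] fun y => oneFormInChart β p y (fieldInChart X p y) := by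
    filter_upwards [hnear] with y hy
    exact (oneFormInChart_fieldInChart β X hy.1).symm
  have hfun : ContMDiffAt (𝓡 n) 𝓘(ℝ, ℝ) ∞ (fun q => β q (X q)) p := by
    rw [contMDiffAt_iff_contDiffAt_comp_symm hp]
    exact (hβ.clm_apply hx).congr_of_eventuallyEq hβX
  have hpair {α : (q : M) → Cotan n q} {X Z : VField n M} (hZD : ∀ q ∈ U, Z q ∈ D q)
      (h : ∀ q ∈ U, ∀ w ∈ D q, α q w = TwoForm.flat η q (X q) w) :
      ∀ᶠ y in 𝓝 (extChartAt (𝓡 n) p p), oneFormInChart α p y (fieldInChart Z p y) =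
        TwoForm.inChart η p y ![fieldInChart X p y, fieldInChart Z p y] := by
    filter_upwards [hnear] with y hy
    rw [oneFormInChart_fieldInChart α Z hy.1, inChart_fieldInChart η X Z hy.1,
      h _ hy.2 _ (hZD _ hy.2), flat_apply]
  -- Involutivity enters here: [Y, Z] lies in D, so α may be exchanged for η(X, ·) on it.
  have hbr {α : (q : M) → Cotan n q} {X Y : VField n M} (hY : SmoothFieldOn Y U)
      (hYD : ∀ q ∈ U, Y q ∈ D q)
      (h : ∀ q ∈ U, ∀ w ∈ D q, α q w = TwoForm.flat η q (X q) w) :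
      oneFormInChart α p (extChartAt (𝓡 n) p p)
        (VectorField.lieBracket ℝ (fieldInChart Y p) (fieldInChart Z p) (extChartAt (𝓡 n) p p)) =
      TwoForm.inChart η p (extChartAt (𝓡 n) p p) ![fieldInChart X p (extChartAt (𝓡 n) p p),
        VectorField.lieBracket ℝ (fieldInChart Y p) (fieldInChart Z p)
          (extChartAt (𝓡 n) p p)] := by
    rw [← mfderiv_extChartAt_mlieBracket, fieldInChart_extChartAt X hp]
    refine (oneFormInChart_mfderiv α hp _).trans ?_
    refine Eq.trans ?_ (inChart_mfderiv η hp _ _).symm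
    exact h p hpU _ (hinv U hU Y Z hY hZ hYD hZD p hpU)
  have key := lieDerivModel_bracket (η := TwoForm.inChart η p) (X := fieldInChart X p)
    (Y := fieldInChart Y p) (Z := fieldInChart Z p) (a := oneFormInChart α p)
    (b := oneFormInChart β p) (y := extChartAt (𝓡 n) p p)
    ((contDiffAt_inChart hη hy₀).differentiableAt (by simp)) (hx.differentiableAt (by simp))
    (hy.differentiableAt (by simp)) (hz.differentiableAt (by simp))
    (hα.differentiableAt (by simp)) (hβ.differentiableAt (by simp)) (hclosed p _ hy₀)
    (hpair hZD hαX) (hpair hZD hβY) (hpair hXD hβY) (hbr hY hYD hαX) (hbr hX hXD hβY)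
  rw [← mfderiv_extChartAt_mlieBracket, ← hβX.fderiv_eq, fieldInChart_extChartAt Z hp] at key
  have hR := inChart_mfderiv η hp (VectorField.mlieBracket (𝓡 n) X Y p) (Z p)
  refine Eq.trans ?_ (key.trans hR)
  rw [sub_apply, sub_apply, diff_apply hfun]
  rfl

theorem isPolyPoisson_diracS (hΩ : IsPolysymplectic Ω) (hD : IsRegularDistribution D r)
    (hinv : IsInvolutive D) (hperp : ∀ p : M, D p ⊓ orthogonal Ω D p = ⊥) :
    IsPolyPoisson (diracS Ω D) (diracSharp hperp) where
  subbundle := isSubbundle_diracS hΩ.smooth hD hperp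
  smooth U hU α hα hαS := smoothFieldOn_sharp hΩ.smooth hD hperp hU hα hαS
  skew p α A := by
    rw [← flat_diracSharp hperp p α A (diracSharp_mem hperp p α), flat_self]
  nondegenerate p α h := by
    refine eq_zero_of_flat_eq_zero (hperp p) (diracSharp_mem hperp p α) fun A w hw => ?_
    rw [flat_diracSharp hperp p α A hw]
    rw [← range_diracSharp hperp p] at hw
    obtain ⟨β, rfl⟩ := hw
    exact h β A
  integrable U hU α β hα hβ hαS hβS p hpU := by
    have hX := smoothFieldOn_sharp hΩ.smooth hD hperp hU hα hαS
    have hY := smoothFieldOn_sharp hΩ.smooth hD hperp hU hβ hβS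
    have hmem {γ : (p : M) → Covel n k p} (hγ : ∀ p ∈ U, γ p ∈ diracS Ω D p) :
        ∀ q ∈ U, sharp (diracSharp hperp) γ q ∈ D q := fun q hq => by
      rw [sharp_of_mem _ _ (hγ q hq)]
      exact diracSharp_mem hperp q _
    have hflat {γ : (p : M) → Covel n k p} (hγ : ∀ p ∈ U, γ p ∈ diracS Ω D p) (A : Fin k) :
        ∀ q ∈ U, ∀ w ∈ D q,
          γ q A w = TwoForm.flat (Ω A) q (sharp (diracSharp hperp) γ q) w := fun q hq w hw => by
      rw [sharp_of_mem _ _ (hγ q hq), flat_diracSharp hperp q _ A hw]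
    have hbr := hinv U hU _ _ hX hY (hmem hαS) (hmem hβS) p hpU
    obtain ⟨U', hU', hpU', Z, hZ, hZD⟩ := hD p
    have hsub : U ∩ U' ⊆ U := Set.inter_subset_left
    have hp := mem_extChartAt_source (I := 𝓡 n) p
    -- Both sides are linear in w, so it suffices to test the local frame of D, whose members are
    -- vector fields to which the bracket identity applies.
    have key : ∀ A, ∀ w ∈ D p,
        (lieDeriv (sharp (diracSharp hperp) α) (fun q => β q A) p
          - lieDeriv (sharp (diracSharp hperp) β) (fun q => α q A) p
          - diff (fun q => β q A (sharp (diracSharp hperp) α q)) p : Cotan n p) w =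
        TwoForm.flat (Ω A) p (VectorField.mlieBracket (𝓡 n) (sharp (diracSharp hperp) α)
          (sharp (diracSharp hperp) β) p) w := by
      intro A w hw
      rw [← (hZD p hpU').2] at hw
      induction hw using Submodule.span_induction with
      | mem w hw =>
        obtain ⟨j, rfl⟩ := hw
        exact lieDeriv_bracket_apply (hΩ.smooth A) (hΩ.closed A) hinv (hU.inter hU')
          (hX.mono hsub) (hY.mono hsub) ((hZ j).mono Set.inter_subset_right)
          (fun q hq => hmem hαS q hq.1) (fun q hq => hmem hβS q hq.1)
          (fun q hq => (hZD q hq.2).2 ▸ Submodule.subset_span ⟨j, rfl⟩) ⟨hpU, hpU'⟩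
          (hα.contDiffAt hU hp hpU A) (hβ.contDiffAt hU hp hpU A)
          (fun q hq => hflat hαS A q hq.1) (fun q hq => hflat hβS A q hq.1)
      | zero => rw [map_zero, map_zero]
      | add u v _ _ hu hv => rw [map_add, map_add, hu, hv]
      | smul a u _ hu => rw [map_smul, map_smul, hu]
    -- The same relation, with witness [X, Y], gives membership in S and the value of Λ^♯.
    exact ⟨⟨_, hbr, key⟩,
      ((diracSharp_eq_iff hperp p _ _).2 ⟨hbr, fun A w hw => (key A w hw).symm⟩).symm⟩

end Integrability

/-! ### Pull-back to integral manifolds -/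

section IntegralManifolds

variable {a n k : ℕ} {L M : Type*} [TopologicalSpace M] [ChartedSpace (Model n) M]
  [IsManifold (𝓡 n) ∞ M] [TopologicalSpace L] [ChartedSpace (Model a) L]
  [IsManifold (𝓡 a) ∞ L] {Ω : Fin k → TwoForm n M} {D : (p : M) → Submodule ℝ (Tan n p)}

/-- The pull-back of a two-form, read in charts. -/
theorem inChart_pullback_eventuallyEq {ι : L → M} (hι : ContMDiff (𝓡 a) (𝓡 n) ∞ ι)
    (η : TwoForm n M) {x : L} {y : Model a} (hy : y ∈ (extChartAt (𝓡 a) x).target) :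
    ∃ (p : M) (g : Model a → Model n), ContDiffAt ℝ ∞ g y ∧ g y ∈ (extChartAt (𝓡 n) p).target ∧
      TwoForm.inChart (TwoForm.pullback (a := a) ι η) x =ᶠ[𝓝 y]
        fun z => (TwoForm.inChart η p (g z)).compContinuousLinearMap (fderiv ℝ g z) := by
  -- The chart on M is centred at the image of the point considered, and g is the local expression
  -- of ι in these charts.
  set p := ι ((extChartAt (𝓡 a) x).symm y)
  have hf : ∀ z ∈ (extChartAt (𝓡 a) x).target,
      ContMDiffAt (𝓡 a) (𝓡 n) ∞ (fun z => ι ((extChartAt (𝓡 a) x).symm z)) z := fun z hz =>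
    hι.contMDiffAt.comp z (contMDiffAt_extChartAt_symm_of_mem hz)
  have hφ : ∀ q ∈ (extChartAt (𝓡 n) p).source,
      ContMDiffAt (𝓡 n) (𝓡 n) ∞ (extChartAt (𝓡 n) p) q := fun q hq =>
    contMDiffAt_extChartAt' (by rwa [extChartAt_source] at hq)
  refine ⟨p, fun z => extChartAt (𝓡 n) p (ι ((extChartAt (𝓡 a) x).symm z)), ?_,
    mem_extChartAt_target p, ?_⟩
  · have h := (hφ p (mem_extChartAt_source p)).comp (I' := 𝓡 n) y (hf y hy)
    exact h.contDiffAt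
  · have hnear := (hf y hy).continuousAt.preimage_mem_nhds
      (extChartAt_source_mem_nhds (I := 𝓡 n) p)
    filter_upwards [extChartAt_target_mem_nhds_of_mem hy, hnear] with z hz hzs
    have hcomp₁ := mfderiv_comp z
      ((hφ _ hzs).mdifferentiableAt (by simp)) ((hf z hz).mdifferentiableAt (by simp))
    have hcomp₂ := mfderiv_comp z
      (hι.mdifferentiableAt (x := (extChartAt (𝓡 a) x).symm z) (by simp))
      ((contMDiffAt_extChartAt_symm_of_mem hz).mdifferentiableAt (by simp))
    have hder (u : Model a) :
        fderiv ℝ (fun z => extChartAt (𝓡 n) p (ι ((extChartAt (𝓡 a) x).symm z))) z u =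
          mfderiv (𝓡 n) (𝓡 n) (extChartAt (𝓡 n) p) (ι ((extChartAt (𝓡 a) x).symm z))
            (mfderiv (𝓡 a) (𝓡 n) ι ((extChartAt (𝓡 a) x).symm z)
              (mfderiv (𝓡 a) (𝓡 a) (extChartAt (𝓡 a) x).symm z u)) := by
      rw [← mfderiv_eq_fderiv]
      refine (congrArg (fun l => l u) hcomp₁).trans ?_
      exact congrArg (fun l => mfderiv (𝓡 n) (𝓡 n) (extChartAt (𝓡 n) p)
        (ι ((extChartAt (𝓡 a) x).symm z)) (l u)) hcomp₂
    refine twoForm_ext fun u v => ?_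
    refine (pullback_apply _ _ _ _ _).trans ((pullback_apply _ _ _ _ _).trans ?_)
    refine (inChart_mfderiv η hzs _ _).symm.trans ?_
    rw [← hder, ← hder]
    change _ = TwoForm.inChart η p _ _
    congr 1
    ext i : 1
    fin_cases i <;> rfl

theorem isSmooth_pullback {ι : L → M} (hι : ContMDiff (𝓡 a) (𝓡 n) ∞ ι) {η : TwoForm n M}
    (hη : TwoForm.IsSmooth η) : TwoForm.IsSmooth (TwoForm.pullback (a := a) ι η) := by
  intro x y hy
  obtain ⟨p, g, hg, hgy, h⟩ := inChart_pullback_eventuallyEq hι η hy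
  refine ContDiffAt.contDiffWithinAt (ContDiffAt.congr_of_eventuallyEq ?_ h)
  exact contDiffAt_twoForm_comp ((contDiffAt_inChart hη hgy).comp y hg)
    (hg.fderiv_right (by simp))

/-- The exterior derivative commutes with pull-back by the local expression of ι, which requires ι
to be C². -/
theorem isClosed_pullback {ι : L → M} (hι : ContMDiff (𝓡 a) (𝓡 n) ∞ ι) {η : TwoForm n M}
    (hη : TwoForm.IsSmooth η) (hclosed : TwoForm.IsClosed η) :
    TwoForm.IsClosed (TwoForm.pullback (a := a) ι η) := by
  intro x y hy
  obtain ⟨p, g, hg, hgy, h⟩ := inChart_pullback_eventuallyEq hι η hy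
  rw [h.extDeriv_eq, extDeriv_pullback ((contDiffAt_inChart hη hgy).differentiableAt (by simp)) hg
    (by
      rw [minSmoothness_of_isRCLikeNormedField]
      exact WithTop.coe_le_coe.2 (le_top : (2 : ℕ∞) ≤ ⊤)), hclosed p _ hgy]
  rfl

omit [IsManifold (𝓡 n) ∞ M] [IsManifold (𝓡 a) ∞ L] in
theorem IsIntegralManifold.mfderiv_mem {ι : L → M} (hι : IsIntegralManifold (a := a) D ι) (q : L)
    (u : Tan a q) : mfderiv (𝓡 a) (𝓡 n) ι q u ∈ D (ι q) :=
  hι.tangent q ▸ ⟨u, rfl⟩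

/-- Integral manifolds of `D` are polysymplectic. -/
theorem IsIntegralManifold.isPolysymplectic_pullback {ι : L → M}
    (hι : IsIntegralManifold (a := a) D ι) (hΩ : IsPolysymplectic Ω)
    (hperp : ∀ p : M, D p ⊓ orthogonal Ω D p = ⊥) :
    IsPolysymplectic (n := a) fun A => TwoForm.pullback (a := a) ι (Ω A) where
  smooth A := isSmooth_pullback hι.smooth (hΩ.smooth A)
  closed A := isClosed_pullback hι.smooth (hΩ.smooth A) (hΩ.closed A)
  nondegenerate q := by
    rw [eq_bot_iff]
    intro u hu
    have hu' := (Submodule.mem_iInf _).1 hu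
    -- Since dι maps onto D, the vector dι(u) lies in D ∩ D^⊥; injectivity of dι then gives u = 0.
    have h0 : mfderiv (𝓡 a) (𝓡 n) ι q u = 0 := by
      refine eq_zero_of_flat_eq_zero (hperp _) (hι.mfderiv_mem q u) fun A w hw => ?_
      rw [← hι.tangent q] at hw
      obtain ⟨v, rfl⟩ := hw
      have h := congrArg (fun l : Cotan a q => l v) (LinearMap.mem_ker.1 (hu' A))
      exact (pullback_apply ι (Ω A) q u v).symm.trans h
    exact (Submodule.mem_bot ℝ).2 (hι.immersion q (h0.trans (map_zero _).symm))

omit [IsManifold (𝓡 n) ∞ M] [IsManifold (𝓡 a) ∞ L] in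
/-- The pulled-back forms are those induced by `(S, Λ^♯)`. -/
theorem IsIntegralManifold.isInducedForm_pullback {ι : L → M}
    (hι : IsIntegralManifold (a := a) D ι) (hperp : ∀ p : M, D p ⊓ orthogonal Ω D p = ⊥) :
    IsInducedForm (a := a) (diracSharp hperp) ι fun A => TwoForm.pullback (a := a) ι (Ω A) := by
  intro q u α h A
  ext v
  refine (pullback_apply ι (Ω A) q u v).trans ?_
  rw [← h]
  exact flat_diracSharp hperp _ α A (hι.mfderiv_mem q v)

end IntegralManifolds

end PolyPoisson

theorem mainTheorem6 {m k r : ℕ} {M : Type*} [TopologicalSpace M]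
    [ChartedSpace (Model m) M] [IsManifold (𝓡 m) ∞ M]
    (Ω : Fin k → TwoForm m M) (hΩ : IsPolysymplectic Ω)
    (D : (p : M) → Submodule ℝ (Tan m p)) (hD : IsRegularDistribution D r)
    (hinv : IsInvolutive D) (hperp : ∀ p : M, D p ⊓ orthogonal Ω D p = ⊥) :
    (∀ p : M, Module.finrank ℝ (diracS Ω D p) = r + (m - r) * k) ∧
    ∃ Λ : (p : M) → diracS Ω D p →ₗ[ℝ] Tan m p,
      (∀ (p : M) (α : diracS Ω D p) (X : Tan m p), Λ p α = X ↔
        X ∈ D p ∧ ∀ A, ∀ w ∈ D p, TwoForm.flat (Ω A) p X w = α.1 A w) ∧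
      IsPolyPoisson (diracS Ω D) Λ ∧
      (∀ p : M, LinearMap.range (Λ p) = D p) ∧
      ∀ (L : Type*) [TopologicalSpace L] [ChartedSpace (Model r) L] [IsManifold (𝓡 r) ∞ L]
        (ι : L → M), IsIntegralManifold (a := r) D ι →
        IsInducedForm (a := r) Λ ι (fun A => TwoForm.pullback (a := r) ι (Ω A)) ∧
        IsPolysymplectic (n := r) (fun A => TwoForm.pullback (a := r) ι (Ω A)) :=
  ⟨finrank_diracS hD hperp, diracSharp hperp, diracSharp_eq_iff hperp,
    isPolyPoisson_diracS hΩ hD hinv hperp, range_diracSharp hperp, fun _ _ _ _ _ hι =>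
      ⟨hι.isInducedForm_pullback hperp, hι.isPolysymplectic_pullback hΩ hperp⟩⟩
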